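/- **Theorem 4.3.** Setting. Let $d\ge 1$, let $\Xi(x)$ be a probability distribution depending (measurably) on $x\in\mathbb R^d$, let $F(x;\xi)$ be a (jointly measurable) real function, and let $f(x)=\mathbb E_{\xi\sim\Xi(x)}[F(x;\xi)]$. A stochastic zeroth-order oracle (SZO) query at $x$ draws a fresh $\xi\sim\Xi(x)$ and returns $F(x;\xi)$. Assume that for all $x,y\in\mathbb R^d$ - $F(x;\cdot)$ has finite second moment under $\Xi(x)$ and $\mathbb E_{\xi\sim\Xi(x)}|F(x;\xi)-f(x)|^2\le\sigma^2$; - $f$ is bounded below and $f(0)-\inf f\le\gamma$; - $|f(x)-f(y)|\le L\|x-y\|$; - $f$ is twice differentiable and $\|\nabla^2f(x)-\nabla^2f(y)\|\le L_H\|x-y\|$ (operator norm), where $L_H>0$. Algorithm ZO-O2NC, with inputs $\delta,\eta>0$ and integers $M,K\ge1$. Put $D=\delta/M$, $x_0=y_0=0$. For $k=1,\dots,K$, set $\Delta_{(k-1)M+1}=0$ and for $t=(k-1)M+1,\dots,kM$ draw $s_t\sim\mathrm{Unif}[0,1]$ and $u_t\sim\mathrm{Unif}(\mathbb S^{d-1})$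 independently of each other and of the past, and put $$y_t=x_{t-1}+s_t\Delta_t,\qquad x_t=x_{t-1}+\Delta_t,\qquad \Delta_{t+1}=\Pi_{\{\|v\|\le D\}}(\Delta_t-\eta g_t),$$ where $\Pi$ is Euclidean projection and - Option I: $g_t=\frac d{2\delta}(h_t^+-h_t^-)u_t$, with $h_t^\pm$ the answers to two SZO queries at $y_t\pm\delta u_t$; - Option II: $g_t=\frac d\delta(h_t-h_{t-1})u_t$, with $h_t$ the answer to one SZO query at $y_t+\delta u_t$, and $h_0$ the answer to one initial SZO query at $y_0+\delta u_0$, $u_0\sim\mathrm{Unif}(\mathbb S^{d-1})$. Finally draw $k_{\rm out}$ uniformly from $\{1,\dots,K\}$, independently, and return $\bar y_{k_{\rm out}}=\frac1M\sum_{t=(k_{\rm out}-1)M+1}^{k_{\rm out}M}y_t$. Claim. For all $L,\sigma\ge0$, $L_H>0$, $\gamma\in\mathbb R$ and $\epsilon_0>0$ there is a constant $C>0$, depending only on these numbers, such that for Option I and for Option II, every $d\ge1$ and every $\epsilon\in(0,\epsilon_0]$ the following holds. With $\delta=\sqrt{\epsilon/(2L_H)}$, there are $M,K\ge1$ and $\eta>0$,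 depending only on the option and on $d,\epsilon,\epsilon_0,L,L_H,\sigma,\gamma$, such that for every problem $(\Xi,F)$ satisfying the assumptions ZO-O2NC finds an $\epsilon$-stationary point in expectation, $$\mathbb E\,\|\nabla f(\bar y_{k_{\rm out}})\|\le\epsilon,$$ and it makes almost surely at most $C\,d^2\,\epsilon^{-9/2}$ SZO queries. -/

import Mathlib

open MeasureTheory ProbabilityTheory

namespace ZOO2NC

/-- The decision space `ℝ^d` with the Euclidean norm. -/
abbrev Vec (d : ℕ) : Type := EuclideanSpace ℝ (Fin d)

/-! ### Problem -/

/-- A stochastic problem with decision-dependent distribution: the sampling law `Ξ(x)`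
(a Markov kernel) and the noisy value `F(x; ξ)`. -/
structure Problem (d : ℕ) (Z : Type*) [MeasurableSpace Z] where
  law : Kernel (Vec d) Z
  isMarkovKernel_law : IsMarkovKernel law
  F : Vec d → Z → ℝ
  measurable_F : Measurable (Function.uncurry F)

/-- The uniform distribution on the unit sphere of `ℝ^d`, as a measure on `ℝ^d`: the normalized
surface measure. -/
noncomputable def unifSphere (d : ℕ) : Measure (Vec d) :=
  (((volume : Measure (Vec d)).toSphere Set.univ)⁻¹ • (volume : Measure (Vec d)).toSphere).map
    Subtype.val

/-- The uniform distribution on `[0, 1]`. -/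
noncomputable def unifInterval : Measure ℝ := volume.restrict (Set.Icc 0 1)

instance : IsProbabilityMeasure unifInterval := ⟨by simp [unifInterval]⟩

instance (d : ℕ) [NeZero d] : IsProbabilityMeasure (unifSphere d) := by
  have : Nontrivial (Vec d) :=
    Module.nontrivial_of_finrank_pos (R := ℝ) (by simpa using NeZero.pos d)
  unfold unifSphere
  have : IsProbabilityMeasure
      (((volume : Measure (Vec d)).toSphere Set.univ)⁻¹ •
        (volume : Measure (Vec d)).toSphere) := by
    refine ⟨?_⟩
    rw [Measure.smul_apply, smul_eq_mul]
    refine ENNReal.inv_mul_cancel ?_ (measure_ne_top _ _)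
    rw [Ne, Measure.measure_univ_eq_zero]
    exact Measure.toSphere_ne_zero _
  exact Measure.isProbabilityMeasure_map (by fun_prop)

namespace Problem

variable {d : ℕ} {Z : Type*} [MeasurableSpace Z] (P : Problem d Z)

instance : IsMarkovKernel P.law := P.isMarkovKernel_law

/-- The objective `f(x) = 𝔼_{ξ ∼ Ξ(x)}[F(x; ξ)]`. -/
noncomputable def objective (x : Vec d) : ℝ := ∫ ξ, P.F x ξ ∂(P.law x)

/-- The oracle: `F(x; ξ)` has finite second moment under `ξ ∼ Ξ(x)`, and its variance around its
mean `f(x)` is at most `σ²`. -/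
def NoiseBound (σ : ℝ) : Prop :=
  ∀ x, MemLp (P.F x) 2 (P.law x) ∧
    ∫ ξ, |P.F x ξ - P.objective x| ^ 2 ∂(P.law x) ≤ σ ^ 2

/-- The stochastic zeroth-order oracle: the distribution of the answer `F(x; ξ)`, `ξ ∼ Ξ(x)`, to a
query at `x`. -/
noncomputable def szo : Kernel (Vec d) ℝ :=
  (Kernel.id ×ₖ P.law).map (Function.uncurry P.F)

instance : IsMarkovKernel P.szo := Kernel.IsMarkovKernel.map _ P.measurable_F

theorem szo_apply (x : Vec d) : P.szo x = (P.law x).map (P.F x) := by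
  have h : Measurable (P.F x) := P.measurable_F.of_uncurry_left
  ext s hs
  rw [szo, Kernel.map_apply' _ P.measurable_F _ hs, Kernel.prod_apply, Kernel.id_apply,
    Measure.dirac_prod, Measure.map_apply (by fun_prop) (P.measurable_F hs),
    Measure.map_apply h hs]
  rfl

/-- One oracle call, made at the point `q a` where `a` is all the data the algorithm holds: the
answer is appended to the data, and the number of calls made so far (the second component)
increases by one. -/
noncomputable def call {A : Type*} [MeasurableSpace A] (q : A → Vec d) (hq : Measurable q) :
    Kernel (A × ℕ) ((A × ℝ) × ℕ) :=
  (Kernel.id ×ₖ P.szo.comap (fun a : A × ℕ => q a.1) (by fun_prop)).map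
    (fun w : (A × ℕ) × ℝ => ((w.1.1, w.2), w.1.2 + 1))

instance {A : Type*} [MeasurableSpace A] (q : A → Vec d) (hq : Measurable q) :
    IsMarkovKernel (P.call q hq) :=
  Kernel.IsMarkovKernel.map _ (by fun_prop)

end Problem

/-- `f` is twice differentiable and its Hessian is `L_H`-Lipschitz in operator norm. -/
def HasLipschitzHessian {d : ℕ} (f : Vec d → ℝ) (L_H : ℝ) : Prop :=
  Differentiable ℝ f ∧ Differentiable ℝ (gradient f) ∧
    ∀ x y, ‖fderiv ℝ (gradient f) x - fderiv ℝ (gradient f) y‖ ≤ L_H * ‖x - y‖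

/-! ### The algorithm -/

/-- Option I (two-point estimator) or Option II (one-point residual estimator). -/
inductive Feedback
  | twoPoint
  | onePoint

/-- The inputs of the algorithm: smoothing radius `δ`, stepsize `η`, block length `M`, number of
blocks `K`. -/
structure Params where
  δ : ℝ
  η : ℝ
  M : ℕ
  K : ℕ

/-- `D = δ / M`. -/
noncomputable def Params.D (p : Params) : ℝ := p.δ / p.M

/-- Euclidean projection onto the closed ball of radius `D` around `0`. -/
noncomputable def projBall {d : ℕ} (D : ℝ) (v : Vec d) : Vec d :=
  if ‖v‖ ≤ D then v else (D / ‖v‖) • v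

theorem projBall_isProjection {d : ℕ} {D : ℝ} (hD : 0 ≤ D) (v : Vec d) :
    projBall D v ∈ Metric.closedBall (0 : Vec d) D ∧
      ∀ w ∈ Metric.closedBall (0 : Vec d) D, ‖v - projBall D v‖ ≤ ‖v - w‖ := by
  unfold projBall
  split_ifs with h
  · exact ⟨by simpa using h, fun w _ => by simp⟩
  · push Not at h
    have hv : 0 < ‖v‖ := hD.trans_lt h
    refine ⟨?_, fun w hw => ?_⟩
    · rw [mem_closedBall_zero_iff, norm_smul, Real.norm_of_nonneg (by positivity),
        div_mul_cancel₀ _ hv.ne']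
    · have h1 : v - (D / ‖v‖) • v = (1 - D / ‖v‖) • v := by rw [sub_smul, one_smul]
      have h2 : 0 ≤ 1 - D / ‖v‖ := by
        rw [sub_nonneg, div_le_one hv]; exact h.le
      rw [h1, norm_smul, Real.norm_of_nonneg h2, sub_mul, one_mul, div_mul_cancel₀ _ hv.ne']
      have h3 := norm_sub_norm_le v w
      rw [mem_closedBall_zero_iff] at hw
      linarith

@[fun_prop]
theorem measurable_projBall {d : ℕ} (D : ℝ) : Measurable (projBall D : Vec d → Vec d) :=
  Measurable.ite (measurableSet_le measurable_norm measurable_const) measurable_id (by fun_prop)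

/-- The data after iteration `t`: `(y_t, g_t, x_t, Δ_{t+1}, h_t)`, where `h_t` is the last oracle
answer. -/
abbrev Core (d : ℕ) : Type := Vec d × Vec d × Vec d × Vec d × ℝ

/-- The data after an iteration, together with the number of oracle calls made so far. -/
abbrev Iterate (d : ℕ) : Type := Core d × ℕ

variable {d : ℕ}

/-- `y_t` -/
abbrev Core.y (c : Core d) : Vec d := c.1

/-- `g_t` -/
abbrev Core.g (c : Core d) : Vec d := c.2.1

/-- `x_t` -/
abbrev Core.x (c : Core d) : Vec d := c.2.2.1

/-- `Δ_{t+1}`, before the reset at the start of a block -/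
abbrev Core.Δ (c : Core d) : Vec d := c.2.2.2.1

/-- `h_t` -/
abbrev Core.h (c : Core d) : ℝ := c.2.2.2.2

/-- The data held inside an iteration once `s_t` and `u_t` are drawn: the data after the previous
iteration, `s_t` and `u_t`. -/
abbrev Drawn (d : ℕ) : Type := Core d × ℝ × Vec d

/-- The data after iteration `n`, once the independent `s_{n+1} ∼ Unif[0,1]` and
`u_{n+1} ∼ Unif(𝕊^{d-1})` are drawn. -/
noncomputable def draw (d : ℕ) : Kernel (Iterate d) (Drawn d × ℕ) :=
  (Kernel.id ×ₖ Kernel.const _ (unifInterval.prod (unifSphere d))).map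
    (fun w : (Core d × ℕ) × ℝ × Vec d => ((w.1.1, w.2), w.1.2))

/-- `Δ_{n+1}` as used in iteration `n + 1`: reset to `0` at the first iteration of a block. -/
noncomputable def currentΔ (p : Params) (n : ℕ) (c : Core d) : Vec d :=
  if n % p.M = 0 then 0 else c.Δ

/-- `y_{n+1} = x_n + s_{n+1} Δ_{n+1}` -/
noncomputable def nextY (p : Params) (n : ℕ) (a : Drawn d) : Vec d :=
  a.1.x + a.2.1 • currentΔ p n a.1

/-- `x_{n+1} = x_n + Δ_{n+1}` -/
noncomputable def nextX (p : Params) (n : ℕ) (a : Drawn d) : Vec d :=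
  a.1.x + currentΔ p n a.1

/-- `y_{n+1} + δ u_{n+1}` -/
noncomputable def queryPlus (p : Params) (n : ℕ) (a : Drawn d) : Vec d :=
  nextY p n a + p.δ • a.2.2

/-- `y_{n+1} - δ u_{n+1}` -/
noncomputable def queryMinus (p : Params) (n : ℕ) (a : Drawn d) : Vec d :=
  nextY p n a - p.δ • a.2.2

/-- The data after iteration `n + 1`, given the gradient estimate `g` and the last answer `h`;
here `Δ_{n+2} = Π_{𝔹(0,D)}(Δ_{n+1} - η g)`. -/
noncomputable def finish (p : Params) (n : ℕ) (a : Drawn d) (g : Vec d) (h : ℝ) : Core d :=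
  (nextY p n a, g, nextX p n a, projBall p.D (currentΔ p n a.1 - p.η • g), h)

/-- `(d / 2δ) (h⁺ - h⁻) u` -/
noncomputable def gTwoPoint (p : Params) (hplus hminus : ℝ) (u : Vec d) : Vec d :=
  ((d : ℝ) / (2 * p.δ) * (hplus - hminus)) • u

/-- `(d / δ) (h_{n+1} - h_n) u` -/
noncomputable def gOnePoint (p : Params) (hnew hold : ℝ) (u : Vec d) : Vec d :=
  ((d : ℝ) / p.δ * (hnew - hold)) • u

@[fun_prop]
theorem measurable_currentΔ (p : Params) (n : ℕ) :
    Measurable (currentΔ p n : Core d → Vec d) := by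
  unfold currentΔ
  split_ifs <;> fun_prop

@[fun_prop]
theorem measurable_nextY (p : Params) (n : ℕ) : Measurable (nextY p n : Drawn d → Vec d) := by
  unfold nextY; fun_prop

@[fun_prop]
theorem measurable_nextX (p : Params) (n : ℕ) : Measurable (nextX p n : Drawn d → Vec d) := by
  unfold nextX; fun_prop

@[fun_prop]
theorem measurable_queryPlus (p : Params) (n : ℕ) :
    Measurable (queryPlus p n : Drawn d → Vec d) := by
  unfold queryPlus; fun_prop

@[fun_prop]
theorem measurable_queryMinus (p : Params) (n : ℕ) :
    Measurable (queryMinus p n : Drawn d → Vec d) := by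
  unfold queryMinus; fun_prop

/-- The update at the end of an iteration of Option I, from `(a, h⁺, h⁻)`. -/
noncomputable def updateTwoPoint (p : Params) (n : ℕ) (w : ((Drawn d × ℝ) × ℝ) × ℕ) :
    Iterate d :=
  (finish p n w.1.1.1 (gTwoPoint p w.1.1.2 w.1.2 w.1.1.1.2.2) w.1.2, w.2)

/-- The update at the end of an iteration of Option II, from `(a, h_{n+1})`. -/
noncomputable def updateOnePoint (p : Params) (n : ℕ) (w : (Drawn d × ℝ) × ℕ) : Iterate d :=
  (finish p n w.1.1 (gOnePoint p w.1.2 w.1.1.1.h w.1.1.2.2) w.1.2, w.2)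

@[fun_prop]
theorem measurable_updateTwoPoint (p : Params) (n : ℕ) :
    Measurable (updateTwoPoint p n : ((Drawn d × ℝ) × ℝ) × ℕ → Iterate d) := by
  unfold updateTwoPoint finish gTwoPoint; fun_prop

@[fun_prop]
theorem measurable_updateOnePoint (p : Params) (n : ℕ) :
    Measurable (updateOnePoint p n : (Drawn d × ℝ) × ℕ → Iterate d) := by
  unfold updateOnePoint finish gOnePoint; fun_prop

section Run

variable [NeZero d] {Z : Type*} [MeasurableSpace Z] (P : Problem d Z) (o : Feedback) (p : Params)

instance : IsMarkovKernel (draw d) := Kernel.IsMarkovKernel.map _ (by fun_prop)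

/-- The transition from the data after iteration `n` to the data after iteration `n + 1`.
Option I calls the oracle at `y + δu` and at `y - δu`; Option II calls it at `y + δu` only. -/
noncomputable def step (n : ℕ) : Kernel (Iterate d) (Iterate d) :=
  match o with
  | .twoPoint =>
      ((P.call (fun a : Drawn d × ℝ => queryMinus p n a.1) (by fun_prop)) ∘ₖ
        (P.call (queryPlus p n) (by fun_prop)) ∘ₖ draw d).map (updateTwoPoint p n)
  | .onePoint =>
      ((P.call (queryPlus p n) (by fun_prop)) ∘ₖ draw d).map (updateOnePoint p n)

instance (n : ℕ) : IsMarkovKernel (step P o p n) := by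
  cases o
  · exact Kernel.IsMarkovKernel.map _ (by fun_prop)
  · exact Kernel.IsMarkovKernel.map _ (by fun_prop)

/-- The law of the data before the first iteration: `x_0 = y_0 = 0`. Option II makes one oracle
call at `y_0 + δ u_0`, `u_0 ∼ Unif(𝕊^{d-1})`, to obtain `h_0`. (The components `g_0` and `Δ_1` are
never read, and neither is `h_0` in Option I.) -/
noncomputable def start : Measure (Iterate d) :=
  match o with
  | .twoPoint => Measure.dirac ((0, 0, 0, 0, 0), 0)
  | .onePoint =>
      ((P.call (fun u : Vec d => (0 : Vec d) + p.δ • u) (by fun_prop)) ∘ₘ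
        ((unifSphere d).map (fun u => (u, 0)))).map
        (fun w : (Vec d × ℝ) × ℕ => ((0, 0, 0, 0, w.1.2), w.2))

instance : IsProbabilityMeasure (start P o p) := by
  cases o
  · exact Measure.dirac.isProbabilityMeasure
  · have : IsProbabilityMeasure ((unifSphere d).map (fun u : Vec d => (u, (0 : ℕ)))) :=
      Measure.isProbabilityMeasure_map (by fun_prop)
    exact Measure.isProbabilityMeasure_map (by fun_prop)

/-- The joint law of the data after iterations `0, 1, 2, …`. -/
noncomputable def run : Measure (ℕ → Iterate d) :=
  Kernel.trajMeasure (X := fun _ => Iterate d) (start P o p)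
    (fun n => (step P o p n).comap
      (fun past : (Π _ : Finset.Iic n, Iterate d) => past ⟨n, by simp⟩) (by fun_prop))

instance : IsProbabilityMeasure (run P o p) := by unfold run; infer_instance

/-- `ȳ_k = (1/M) ∑_{t=(k-1)M+1}^{kM} y_t`; the blocks are numbered from `0` here. -/
noncomputable def blockAverage (ω : ℕ → Iterate d) (k : Fin p.K) : Vec d :=
  (p.M : ℝ)⁻¹ • ∑ m ∈ Finset.range p.M, (ω ((k : ℕ) * p.M + m + 1)).1.y

/-- The law of the output `ȳ_{k_out}`, where `k_out` is uniform on the `K` blocks and independent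
of the run. -/
noncomputable def output : Measure (Vec d) :=
  ((run P o p).prod (uniformOn (Set.univ : Set (Fin p.K)))).map
    (fun w => blockAverage p w.1 w.2)

theorem measurable_blockAverage :
    Measurable (fun w : (ℕ → Iterate d) × Fin p.K => blockAverage p w.1 w.2) := by
  refine measurable_from_prod_countable_left fun k => ?_
  simp only [blockAverage]
  fun_prop

theorem isProbabilityMeasure_output (hK : 0 < p.K) : IsProbabilityMeasure (output P o p) := by
  have : NeZero p.K := ⟨hK.ne'⟩
  have : IsProbabilityMeasure (uniformOn (Set.univ : Set (Fin p.K))) :=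
    isProbabilityMeasure_uniformOn Set.finite_univ Set.univ_nonempty
  exact Measure.isProbabilityMeasure_map (measurable_blockAverage p).aemeasurable

/-- The number of oracle calls made up to the end of the `T = K M` iterations. -/
def queries (ω : ℕ → Iterate d) : ℕ := (ω (p.K * p.M)).2

end Run

end ZOO2NC

/-! The proof is an online-to-nonconvex conversion. Since `y_t` is uniform on the segment from
`x_{t-1}` to `x_t = x_{t-1} + Δ_t`, the fundamental theorem of calculus gives, conditionally on the
past, the exact identity E⟨∇f(y_t), Δ_t⟩ = f(x_t) - f(x_{t-1}) (`integral_step_progress`). So the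
decrease of `f` is a linear loss in `Δ_t`, and choosing `Δ_t` is an online linear problem on the
ball of radius `D`, solved in each block by projected gradient descent.

The feedback is `g_t`. By the divergence theorem on the ball (`setIntegral_ball_fderiv`), its
conditional mean is that of the average of ∇f over the ball of radius `δ` about `y_t`. The linear
term of the Taylor expansion is odd and averages out, so the bias is at most L_H δ²/2
(`norm_meanEstimate_sub_gradient_le`). The second moment of `g_t` is of order d²(σ²/δ² + L²), for
Option II as well: consecutive points `y` are at most `2D` apart, and the error of the carried
answer is bounded independently of the earlier estimates, so no recursion arises
(`lintegral_stepLaw_estimate_le`, `lintegral_run_carriedError_le`).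

With A the sum of the gradients in a block, the regret against -D A/‖A‖ bounds D‖A‖ by the decrease
of `f`, the bias, the norm of the accumulated noise and the regret of gradient descent
(`mul_norm_sum_le`). The noise consists of martingale differences, so over a block its norm is of
order √M times one standard deviation (`integral_noiseSum_sq_le`). The points of a block lie within
M D = δ of each other, so the gradient at their average differs from A/M by at most L_H δ²/2
(`norm_gradient_average_le`). Summing over blocks telescopes the decrease of `f`
(`integral_norm_gradient_output_le`).

With δ² = ε/(2L_H), bias and averaging cost 3ε/4. The other two terms are at most ε/8 each when M is
of order d²ε⁻³ and K of order ε^(-3/2), hence about d²ε^(-9/2) queries. -/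

namespace ZOO2NC

/-! ### The uniform distribution on the sphere -/

section Sphere

variable {d : ℕ}

/-- The direction `v / ‖v‖`. -/
noncomputable def direction (v : Vec d) : Vec d := ‖v‖⁻¹ • v

@[fun_prop]
theorem measurable_direction : Measurable (direction : Vec d → Vec d) := by
  unfold direction; fun_prop

theorem norm_direction {v : Vec d} (hv : v ≠ 0) : ‖direction v‖ = 1 := by
  simp [direction, norm_smul, hv]

/-- The zero vector has direction `0`, because `0⁻¹ = 0`; this is the only case of strict
inequality. -/
theorem norm_direction_le (v : Vec d) : ‖direction v‖ ≤ 1 := by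
  rcases eq_or_ne v 0 with rfl | hv
  · simp [direction]
  · exact (norm_direction hv).le

theorem direction_smul {r : ℝ} (hr : 0 < r) (v : Vec d) : direction (r • v) = direction v := by
  simp only [direction, norm_smul, Real.norm_of_nonneg hr.le, smul_smul]
  congr 1
  field_simp

theorem direction_neg (v : Vec d) : direction (-v) = -direction v := by
  simp [direction]

theorem norm_sub_direction {v : Vec d} (hv : v ≠ 0) (h1 : ‖v‖ ≤ 1) :
    ‖v - direction v‖ = 1 - ‖v‖ := by
  have hpos : 0 < ‖v‖ := norm_pos_iff.2 hv
  have : v - direction v = (1 - ‖v‖⁻¹) • v := by simp [direction, sub_smul]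
  rw [this, norm_smul, Real.norm_eq_abs, abs_of_nonpos]
  · field_simp; ring
  · rw [sub_nonpos, one_le_inv₀ hpos]; exact h1

-- The surface measure of a set is `d` times the volume of the open cone over it, and that cone is
-- the preimage under `direction` within the ball, up to the origin. Sphere integrals thereby become
-- ball integrals, where scaling and integration by parts are available.
open scoped Pointwise in
theorem toSphere_map_val [NeZero d] :
    ((volume : Measure (Vec d)).toSphere).map Subtype.val =
      (d : ENNReal) • ((volume.restrict (Metric.ball (0 : Vec d) 1)).map direction) := by
  have : Nontrivial (Vec d) :=
    Module.nontrivial_of_finrank_pos (R := ℝ) (by simpa using NeZero.pos d)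
  ext s hs
  rw [Measure.map_apply measurable_subtype_coe hs, Measure.smul_apply,
    Measure.map_apply measurable_direction hs,
    Measure.restrict_apply (measurable_direction hs),
    Measure.toSphere_apply' _ (measurable_subtype_coe hs), finrank_euclideanSpace_fin, smul_eq_mul]
  congr 1
  have h1 : (Set.Ioo (0 : ℝ) 1 • (Subtype.val '' (Subtype.val ⁻¹' s :
      Set (Metric.sphere (0 : Vec d) 1)))) =
      (direction ⁻¹' s ∩ Metric.ball 0 1) \ {0} := by
    ext v
    simp only [Set.mem_smul, Set.mem_image, Set.mem_preimage, Subtype.exists, Set.mem_sdiff,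
      Set.mem_inter_iff, mem_ball_zero_iff, Set.mem_singleton_iff, Set.mem_Ioo]
    constructor
    · rintro ⟨r, ⟨hr0, hr1⟩, _, ⟨u, hu, hus, rfl⟩, rfl⟩
      have hu1 : ‖u‖ = 1 := by simpa using hu
      refine ⟨⟨?_, ?_⟩, ?_⟩
      · rw [direction_smul hr0]
        simpa [direction, hu1] using hus
      · rw [norm_smul, hu1, Real.norm_of_nonneg hr0.le]; simpa using hr1
      · intro h0
        have := congrArg norm h0
        rw [norm_smul, hu1, Real.norm_of_nonneg hr0.le, norm_zero] at this
        linarith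
    · rintro ⟨⟨hs', hv1⟩, hv0⟩
      refine ⟨‖v‖, ⟨norm_pos_iff.2 hv0, hv1⟩, direction v, ⟨direction v, ?_, hs', rfl⟩, ?_⟩
      · simpa using norm_direction hv0
      · simp [direction, smul_smul, norm_ne_zero_iff.2 hv0]
  rw [h1, measure_sdiff_null (measure_singleton _)]

theorem volume_ball_ne_zero : (volume (Metric.ball (0 : Vec d) 1)) ≠ 0 :=
  (Metric.measure_ball_pos _ _ one_pos).ne'

theorem volume_real_ball_pos : 0 < volume.real (Metric.ball (0 : Vec d) 1) :=
  ENNReal.toReal_pos volume_ball_ne_zero measure_ball_lt_top.ne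

theorem unifSphere_eq [NeZero d] :
    unifSphere d = (volume (Metric.ball (0 : Vec d) 1))⁻¹ •
      ((volume.restrict (Metric.ball (0 : Vec d) 1)).map direction) := by
  rw [unifSphere, Measure.map_smul, toSphere_map_val, Measure.toSphere_apply_univ, smul_smul,
    finrank_euclideanSpace_fin]
  congr 1
  have hd : (d : ENNReal) ≠ 0 := by simpa using NeZero.ne d
  rw [ENNReal.mul_inv (Or.inl hd) (Or.inl (by simp)), mul_comm, ← mul_assoc,
    ENNReal.mul_inv_cancel hd (by simp), one_mul]

theorem integral_unifSphere [NeZero d] {F : Type*} [NormedAddCommGroup F] [NormedSpace ℝ F]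
    {φ : Vec d → F} (hφ : StronglyMeasurable φ) :
    ∫ u, φ u ∂(unifSphere d) = (volume.real (Metric.ball (0 : Vec d) 1))⁻¹ •
      ∫ v in Metric.ball (0 : Vec d) 1, φ (direction v) := by
  rw [unifSphere_eq, integral_smul_measure, integral_map (by fun_prop) hφ.aestronglyMeasurable,
    ENNReal.toReal_inv]
  rfl

theorem ae_norm_unifSphere [NeZero d] : ∀ᵐ u ∂(unifSphere d), ‖u‖ = 1 := by
  rw [unifSphere_eq]
  refine Measure.ae_smul_measure ?_ _
  rw [ae_map_iff (by fun_prop) (measurableSet_eq_fun measurable_norm measurable_const)]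
  refine ae_restrict_of_ae ?_
  have : Nontrivial (Vec d) :=
    Module.nontrivial_of_finrank_pos (R := ℝ) (by simpa using NeZero.pos d)
  have h0 : ∀ᵐ v : Vec d ∂volume, v ≠ 0 := by
    rw [ae_iff]; simp
  filter_upwards [h0] with v hv using norm_direction hv

theorem setIntegral_ball_neg {F : Type*} [NormedAddCommGroup F] [NormedSpace ℝ F]
    (φ : Vec d → F) :
    ∫ v in Metric.ball (0 : Vec d) 1, φ (-v) = ∫ v in Metric.ball (0 : Vec d) 1, φ v := by
  have h := (Measure.measurePreserving_neg (volume : Measure (Vec d))).setIntegral_preimage_emb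
    (MeasurableEquiv.neg (Vec d)).measurableEmbedding φ (Metric.ball 0 1)
  have h2 : (Neg.neg : Vec d → Vec d) ⁻¹' Metric.ball 0 1 = Metric.ball 0 1 := by
    ext; simp
  rw [h2] at h
  exact h

theorem integral_unifSphere_neg [NeZero d] {F : Type*} [NormedAddCommGroup F] [NormedSpace ℝ F]
    {φ : Vec d → F} (hφ : StronglyMeasurable φ) :
    ∫ u, φ (-u) ∂(unifSphere d) = ∫ u, φ u ∂(unifSphere d) := by
  rw [integral_unifSphere hφ,
    integral_unifSphere (φ := fun u => φ (-u)) (hφ.comp_measurable measurable_neg)]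
  simp_rw [← direction_neg]
  rw [setIntegral_ball_neg (fun v => φ (direction v))]

-- The integrand does not change under positive scaling, so only the Jacobian `r ^ d` appears.
open scoped Pointwise in
theorem setIntegral_ball_direction {F : Type*} [NormedAddCommGroup F] [NormedSpace ℝ F]
    (ψ : Vec d → F) {r : ℝ} (hr : 0 < r) :
    ∫ v in Metric.ball (0 : Vec d) r, ψ (direction v) =
      r ^ d • ∫ v in Metric.ball (0 : Vec d) 1, ψ (direction v) := by
  have h := Measure.setIntegral_comp_smul_of_pos (volume : Measure (Vec d))
    (fun v => ψ (direction v)) (Metric.ball 0 1) hr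
  simp only [direction_smul hr, finrank_euclideanSpace_fin] at h
  rw [smul_unitBall_of_pos hr] at h
  rw [h, smul_smul, mul_inv_cancel₀ (pow_pos hr d).ne', one_smul]

theorem volume_real_ball {r : ℝ} (hr : 0 < r) :
    volume.real (Metric.ball (0 : Vec d) r) =
      r ^ d * volume.real (Metric.ball (0 : Vec d) 1) := by
  have := setIntegral_ball_direction (d := d) (fun _ => (1 : ℝ)) hr
  simpa using this

/-- Radial cutoff: `1` on the ball of radius `1 - h`, `0` off the unit ball. -/
noncomputable def radialCutoff (h : ℝ) (v : Vec d) : ℝ := max 0 (min 1 (h⁻¹ * (1 - ‖v‖)))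

theorem lipschitzWith_radialCutoff {h : ℝ} (hh : 0 < h) :
    LipschitzWith (Real.toNNReal h⁻¹) (radialCutoff h : Vec d → ℝ) := by
  have h1 : LipschitzWith (Real.toNNReal h⁻¹) (fun v : Vec d => h⁻¹ * (1 - ‖v‖)) := by
    refine LipschitzWith.of_dist_le_mul fun x y => ?_
    rw [Real.coe_toNNReal _ (by positivity), Real.dist_eq, dist_eq_norm, ← mul_sub, abs_mul,
      abs_of_pos (by positivity : (0 : ℝ) < h⁻¹)]
    gcongr
    rw [show 1 - ‖x‖ - (1 - ‖y‖) = -(‖x‖ - ‖y‖) by ring, abs_neg]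
    exact abs_norm_sub_norm_le x y
  exact (h1.const_min 1).const_max 0

theorem hasCompactSupport_radialCutoff {h : ℝ} (hh : 0 < h) :
    HasCompactSupport (radialCutoff h : Vec d → ℝ) := by
  refine HasCompactSupport.intro (isCompact_closedBall (0 : Vec d) 1) fun x hx => ?_
  have : 1 < ‖x‖ := by simpa using hx
  have h2 : h⁻¹ * (1 - ‖x‖) ≤ 0 :=
    mul_nonpos_of_nonneg_of_nonpos (by positivity) (by linarith)
  simp only [radialCutoff]
  rw [max_eq_left]
  exact (min_le_right _ _).trans h2

/-- The cutoff is constant inside and outside the annulus and affine in `‖v‖` on it. The two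
excluded spheres, where it may have a kink, are null sets. The direction `-w` is the one that
integration by parts produces. -/
theorem lineDeriv_radialCutoff {h : ℝ} (hh : 0 < h) (hh1 : h < 1) (w v : Vec d)
    (hv1 : ‖v‖ ≠ 1) (hv2 : ‖v‖ ≠ 1 - h) :
    lineDeriv ℝ (radialCutoff h) v (-w) =
      (Metric.ball (0 : Vec d) 1 \ Metric.ball 0 (1 - h)).indicator
        (fun v => h⁻¹ * inner ℝ (direction v) w) v := by
  have hcont : Continuous (fun x : Vec d => ‖x‖) := continuous_norm
  rcases lt_or_gt_of_ne hv1 with h1 | h1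
  · rcases lt_or_gt_of_ne hv2 with h2 | h2
    · rw [Set.indicator_of_notMem (by simp [h1, h2])]
      have : radialCutoff h =ᶠ[nhds v] fun _ => (1 : ℝ) := by
        filter_upwards [hcont.continuousAt.eventually_lt_const h2] with x hx
        have : 1 ≤ h⁻¹ * (1 - ‖x‖) := by
          rw [inv_mul_eq_div, le_div_iff₀ hh]; linarith
        simp [radialCutoff, min_eq_left this]
      rw [this.lineDeriv_eq]
      simp [lineDeriv]
    · have hmem : v ∈ Metric.ball (0 : Vec d) 1 \ Metric.ball 0 (1 - h) := by
        simp [h1, h2.le]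
      rw [Set.indicator_of_mem hmem]
      have : radialCutoff h =ᶠ[nhds v] fun x => h⁻¹ * (1 - ‖x‖) := by
        filter_upwards [hcont.continuousAt.eventually_const_lt h2,
          hcont.continuousAt.eventually_lt_const h1] with x hx hx'
        have h3 : h⁻¹ * (1 - ‖x‖) ≤ 1 := by
          rw [inv_mul_eq_div, div_le_iff₀ hh]; linarith
        have h4 : 0 ≤ h⁻¹ * (1 - ‖x‖) := mul_nonneg (by positivity) (by linarith)
        simp [radialCutoff, min_eq_right h3, max_eq_right h4]
      rw [this.lineDeriv_eq]
      have hv0 : v ≠ 0 := by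
        rintro rfl
        simp at h2; linarith
      have hd := (hasStrictFDerivAt_norm_sq v).hasFDerivAt.sqrt (by
        simpa using hv0)
      have hd' : HasFDerivAt (fun x : Vec d => ‖x‖) _ v :=
        hd.congr_of_eventuallyEq (Filter.Eventually.of_forall fun x => by simp)
      have hd2 := ((hd'.const_sub 1).const_mul h⁻¹)
      rw [(hd2.hasLineDerivAt (-w)).lineDeriv]
      have : ‖v‖ ≠ 0 := by simpa using hv0
      simp [direction, inner_smul_left]
      left
      field_simp
  · rw [Set.indicator_of_notMem (by simp [h1.le])]
    have : radialCutoff h =ᶠ[nhds v] fun _ => (0 : ℝ) := by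
      filter_upwards [hcont.continuousAt.eventually_const_lt h1] with x hx
      have : h⁻¹ * (1 - ‖x‖) ≤ 0 :=
        mul_nonpos_of_nonneg_of_nonpos (by positivity) (by linarith)
      simp [radialCutoff, this]
    rw [this.lineDeriv_eq]
    simp [lineDeriv]

end Sphere
-- The divergence theorem on the unit ball, by a radial cutoff
section Divergence

variable {d : ℕ}

/-- The annulus `1 - h ≤ ‖v‖ < 1`. -/
def annulus (d : ℕ) (h : ℝ) : Set (Vec d) := Metric.ball (0 : Vec d) 1 \ Metric.ball 0 (1 - h)

theorem measurableSet_annulus (h : ℝ) : MeasurableSet (annulus d h) :=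
  measurableSet_ball.diff measurableSet_ball

theorem volume_annulus_lt_top (h : ℝ) : volume (annulus d h) < ⊤ :=
  (measure_mono Set.sdiff_subset).trans_lt measure_ball_lt_top

theorem volume_real_annulus {h : ℝ} (hh : 0 < h) (hh1 : h < 1) :
    volume.real (annulus d h) =
      (1 - (1 - h) ^ d) * volume.real (Metric.ball (0 : Vec d) 1) := by
  rw [annulus, measureReal_sdiff (Metric.ball_subset_ball (by linarith))
    measurableSet_ball measure_ball_lt_top.ne, volume_real_ball (r := 1 - h) (by linarith)]
  ring

theorem setIntegral_annulus_direction {ψ : Vec d → ℝ} {h : ℝ} (hh : 0 < h) (hh1 : h < 1)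
    (hψ : IntegrableOn (fun v => ψ (direction v)) (Metric.ball (0 : Vec d) 1)) :
    ∫ v in annulus d h, ψ (direction v) =
      (1 - (1 - h) ^ d) * ∫ v in Metric.ball (0 : Vec d) 1, ψ (direction v) := by
  rw [annulus, setIntegral_sdiff measurableSet_ball hψ
    (Metric.ball_subset_ball (by linarith)), setIntegral_ball_direction _ (by linarith : 0 < 1 - h),
    smul_eq_mul]
  ring

theorem ae_norm_ne [NeZero d] (r : ℝ) : ∀ᵐ v : Vec d, ‖v‖ ≠ r := by
  have : Nontrivial (Vec d) :=
    Module.nontrivial_of_finrank_pos (R := ℝ) (by simpa using NeZero.pos d)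
  rw [ae_iff]
  have := Measure.addHaar_sphere (volume : Measure (Vec d)) 0 r
  convert this using 2
  ext; simp

/-- Integration by parts against `radialCutoff h` turns the ball integral of the derivative into an
integral over a thin annulus, which approximates the sphere integral. There are two errors, each at
most `L * ‖w‖` times the volume of the annulus. -/
theorem abs_setIntegral_sub_le [NeZero d] {f : Vec d → ℝ} {L : NNReal} (hf : LipschitzWith L f)
    (hd : ContDiff ℝ 1 f) (w : Vec d) {h : ℝ} (hh : 0 < h) (hh1 : h < 1) :
    |(∫ v in Metric.ball (0 : Vec d) 1, fderiv ℝ f v w) -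
      (h⁻¹ * (1 - (1 - h) ^ d)) *
        ∫ v in Metric.ball (0 : Vec d) 1, f (direction v) * inner ℝ (direction v) w| ≤
      2 * L * ‖w‖ * ((1 - (1 - h) ^ d) * volume.real (Metric.ball (0 : Vec d) 1)) := by
  set B := Metric.ball (0 : Vec d) 1 with hB
  have hBm : MeasurableSet B := measurableSet_ball
  have hcut : Continuous (radialCutoff h : Vec d → ℝ) := (lipschitzWith_radialCutoff hh).continuous
  have hcont : Continuous (fun v => fderiv ℝ f v w) :=
    (hd.continuous_fderiv (by norm_num)).clm_apply continuous_const
  have hfin : ∀ v, |fderiv ℝ f v w| ≤ L * ‖w‖ := fun v =>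
    ((fderiv ℝ f v).le_opNorm w).trans (by gcongr; exact norm_fderiv_le_of_lipschitz ℝ hf)
  have hcut01 : ∀ v : Vec d, 0 ≤ radialCutoff h v ∧ radialCutoff h v ≤ 1 := fun v =>
    ⟨le_max_left _ _, max_le zero_le_one (min_le_left _ _)⟩
  have hpart := LipschitzWith.integral_lineDeriv_mul_eq (μ := (volume : Measure (Vec d))) hf
    (lipschitzWith_radialCutoff hh) (hasCompactSupport_radialCutoff hh) w
  have hl : ∀ v, lineDeriv ℝ f v w = fderiv ℝ f v w := fun v =>
    ((hd.differentiable (by norm_num)) v).lineDeriv_eq_fderiv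
  have hr : (fun v => lineDeriv ℝ (radialCutoff h) v (-w) * f v) =ᵐ[volume]
      (annulus d h).indicator (fun v => h⁻¹ * inner ℝ (direction v) w * f v) := by
    filter_upwards [ae_norm_ne (d := d) 1, ae_norm_ne (d := d) (1 - h)] with v h1 h2
    rw [lineDeriv_radialCutoff hh hh1 w v h1 h2]
    change (annulus d h).indicator _ v * f v = _
    by_cases hv : v ∈ annulus d h
    · rw [Set.indicator_of_mem hv, Set.indicator_of_mem hv]
    · rw [Set.indicator_of_notMem hv, Set.indicator_of_notMem hv, zero_mul]
  rw [integral_congr_ae hr, integral_indicator (measurableSet_annulus h)] at hpart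
  simp_rw [hl] at hpart
  have hzero : ∀ v ∉ B, fderiv ℝ f v w * radialCutoff h v = 0 := by
    intro v hv
    have hv1 : 1 ≤ ‖v‖ := by simpa [hB] using hv
    have : h⁻¹ * (1 - ‖v‖) ≤ 0 := mul_nonpos_of_nonneg_of_nonpos (by positivity) (by linarith)
    simp [radialCutoff, this]
  rw [← setIntegral_eq_integral_of_forall_compl_eq_zero hzero] at hpart
  have hint1 : IntegrableOn (fun v => fderiv ℝ f v w) B :=
    (hcont.continuousOn.integrableOn_compact (isCompact_closedBall 0 1)).mono_set
      Metric.ball_subset_closedBall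
  have hint2 : IntegrableOn (fun v => fderiv ℝ f v w * radialCutoff h v) B :=
    ((hcont.mul hcut).continuousOn.integrableOn_compact (isCompact_closedBall 0 1)).mono_set
      Metric.ball_subset_closedBall
  -- First error: inside the ball, the cutoff differs from `1` only on the annulus.
  have hsmall1 : |(∫ v in B, fderiv ℝ f v w) - ∫ v in B, fderiv ℝ f v w * radialCutoff h v| ≤
      L * ‖w‖ * volume.real (annulus d h) := by
    rw [← integral_sub hint1 hint2]
    have : ∀ v ∈ B \ annulus d h, fderiv ℝ f v w - fderiv ℝ f v w * radialCutoff h v = 0 := by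
      rintro v ⟨hvB, hv⟩
      have hv1 : ‖v‖ < 1 - h := by
        by_contra hcon
        exact hv ⟨hvB, by simpa using hcon⟩
      have : 1 ≤ h⁻¹ * (1 - ‖v‖) := by
        rw [inv_mul_eq_div, le_div_iff₀ hh]; linarith
      simp [radialCutoff, min_eq_left this]
    have hsub : annulus d h ⊆ B := Set.sdiff_subset
    rw [setIntegral_eq_of_subset_of_forall_sdiff_eq_zero hBm hsub this,
      ← Real.norm_eq_abs]
    refine norm_setIntegral_le_of_norm_le_const (volume_annulus_lt_top h) fun v _ => ?_
    have h0 := hcut01 v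
    rw [Real.norm_eq_abs, ← mul_one_sub, abs_mul, abs_of_nonneg (by linarith : 0 ≤ 1 - radialCutoff h v)]
    calc _ ≤ |fderiv ℝ f v w| * 1 := by gcongr; linarith
      _ ≤ _ := by rw [mul_one]; exact hfin v
  have hmeas : Measurable (fun v => f (direction v) * inner ℝ (direction v) w) := by
    have := hf.continuous.measurable
    fun_prop
  have hbd : ∀ v : Vec d, ‖f (direction v) * inner ℝ (direction v) w‖ ≤ (|f 0| + L) * ‖w‖ := by
    intro v
    rw [norm_mul]
    have h1 : ‖f (direction v)‖ ≤ |f 0| + L := by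
      have := hf.dist_le_mul (direction v) 0
      rw [dist_zero_right, Real.dist_eq] at this
      have h2 : (L : ℝ) * ‖direction v‖ ≤ L := by
        simpa using mul_le_mul_of_nonneg_left (norm_direction_le v) L.2
      rw [Real.norm_eq_abs]
      have h3 : f (direction v) = f 0 + (f (direction v) - f 0) := by ring
      rw [h3]
      exact (abs_add_le _ _).trans (by linarith)
    have h2 : ‖inner ℝ (direction v) w‖ ≤ ‖w‖ :=
      (norm_inner_le_norm _ _).trans
        (by simpa using mul_le_mul_of_nonneg_right (norm_direction_le v) (norm_nonneg w))
    gcongr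
  have hintJ : IntegrableOn (fun v => f (direction v) * inner ℝ (direction v) w) B :=
    Measure.integrableOn_of_bounded measure_ball_lt_top.ne hmeas.aestronglyMeasurable
      (Filter.Eventually.of_forall hbd)
  have hA := setIntegral_annulus_direction (ψ := fun u => f u * inner ℝ u w) hh hh1 hintJ
  have hintA : IntegrableOn (fun v => h⁻¹ * (f (direction v) * inner ℝ (direction v) w))
      (annulus d h) := (hintJ.mono_set Set.sdiff_subset).const_mul _
  have hintA2 : IntegrableOn (fun v => h⁻¹ * inner ℝ (direction v) w * f v) (annulus d h) := by
    obtain ⟨C, hC⟩ := (isCompact_closedBall (0 : Vec d) 1).exists_bound_of_continuousOn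
      hf.continuous.continuousOn
    refine Measure.integrableOn_of_bounded (M := h⁻¹ * ‖w‖ * C) (volume_annulus_lt_top h).ne ?_ ?_
    · have := hf.continuous.measurable
      have : Measurable (fun v => h⁻¹ * inner ℝ (direction v) w * f v) := by fun_prop
      exact this.aestronglyMeasurable
    · refine (ae_restrict_iff' (measurableSet_annulus h)).2 (Filter.Eventually.of_forall ?_)
      intro v hv
      rw [norm_mul, norm_mul, Real.norm_of_nonneg (by positivity : 0 ≤ h⁻¹)]
      have h1 := hC v (Metric.ball_subset_closedBall hv.1)
      have h2 : ‖inner ℝ (direction v) w‖ ≤ ‖w‖ :=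
        (norm_inner_le_norm _ _).trans
          (by simpa using mul_le_mul_of_nonneg_right (norm_direction_le v) (norm_nonneg w))
      gcongr
  -- Second error: moving `v` radially to the sphere changes `f` by at most `L * h`, which cancels
  -- the factor `h⁻¹`.
  have hsmall2 : |(∫ v in annulus d h, h⁻¹ * inner ℝ (direction v) w * f v) -
      ∫ v in annulus d h, h⁻¹ * (f (direction v) * inner ℝ (direction v) w)| ≤
      L * ‖w‖ * volume.real (annulus d h) := by
    rw [← integral_sub hintA2 hintA, ← Real.norm_eq_abs]
    refine norm_setIntegral_le_of_norm_le_const (volume_annulus_lt_top h) fun v hv => ?_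
    have hv1 : ‖v‖ < 1 := by simpa using hv.1
    have hv2 : 1 - h ≤ ‖v‖ := by simpa using hv.2
    have hv0 : v ≠ 0 := by
      rintro rfl
      rw [norm_zero] at hv2; linarith
    have h1 : |f v - f (direction v)| ≤ L * h := by
      have := hf.dist_le_mul v (direction v)
      rw [Real.dist_eq, dist_eq_norm, norm_sub_direction hv0 hv1.le] at this
      exact this.trans (by gcongr; linarith)
    have h2 : |inner ℝ (direction v) w| ≤ ‖w‖ :=
        (abs_real_inner_le_norm _ _).trans
          (by simpa using mul_le_mul_of_nonneg_right (norm_direction_le v) (norm_nonneg w))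
    have h3 : h⁻¹ * inner ℝ (direction v) w * f v -
        h⁻¹ * (f (direction v) * inner ℝ (direction v) w) =
        h⁻¹ * inner ℝ (direction v) w * (f v - f (direction v)) := by ring
    rw [h3, norm_mul, norm_mul, Real.norm_of_nonneg (by positivity : 0 ≤ h⁻¹)]
    calc _ ≤ h⁻¹ * ‖w‖ * (L * h) := by
            simp only [Real.norm_eq_abs]; gcongr
      _ = L * ‖w‖ := by field_simp
  rw [integral_const_mul, hA, ← hpart] at hsmall2
  rw [volume_real_annulus hh hh1] at hsmall1 hsmall2
  rw [abs_le] at hsmall1 hsmall2 ⊢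
  constructor <;> nlinarith [hsmall1.1, hsmall1.2, hsmall2.1, hsmall2.2]

/-- The divergence theorem on the unit ball. -/
theorem setIntegral_ball_fderiv [NeZero d] {f : Vec d → ℝ} {L : NNReal} (hf : LipschitzWith L f)
    (hd : ContDiff ℝ 1 f) (w : Vec d) :
    ∫ v in Metric.ball (0 : Vec d) 1, fderiv ℝ f v w =
      d * ∫ v in Metric.ball (0 : Vec d) 1, f (direction v) * inner ℝ (direction v) w := by
  set I := ∫ v in Metric.ball (0 : Vec d) 1, fderiv ℝ f v w
  set J := ∫ v in Metric.ball (0 : Vec d) 1, f (direction v) * inner ℝ (direction v) w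
  set V := volume.real (Metric.ball (0 : Vec d) 1)
  -- As `h` tends to `0` from the right, the relative volume of the annulus divided by `h` tends to
  -- `d`, while the error bound, proportional to that volume, vanishes.
  have hder : HasDerivAt (fun h : ℝ => 1 - (1 - h) ^ d) d 0 := by
    have := (((hasDerivAt_id (0 : ℝ)).const_sub 1).pow d).const_sub 1
    simpa using this
  have hT1 : Filter.Tendsto (fun h : ℝ => h⁻¹ * (1 - (1 - h) ^ d)) (nhdsWithin 0 (Set.Ioi 0))
      (nhds (d : ℝ)) := by
    have := hder.tendsto_slope_zero_right
    simpa using this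
  have hT2 : Filter.Tendsto (fun h : ℝ => 1 - (1 - h) ^ d) (nhdsWithin 0 (Set.Ioi 0))
      (nhds 0) := by
    have h2 : Filter.Tendsto (fun h : ℝ => 1 - (1 - h) ^ d) (nhds 0) (nhds _) :=
      hder.continuousAt.tendsto
    simp only [sub_zero, one_pow, sub_self] at h2
    exact h2.mono_left nhdsWithin_le_nhds
  have hL : Filter.Tendsto (fun h : ℝ => |I - (h⁻¹ * (1 - (1 - h) ^ d)) * J|)
      (nhdsWithin 0 (Set.Ioi 0)) (nhds |I - d * J|) :=
    (tendsto_const_nhds.sub (hT1.mul_const J)).abs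
  have hR : Filter.Tendsto (fun h : ℝ => 2 * L * ‖w‖ * ((1 - (1 - h) ^ d) * V))
      (nhdsWithin 0 (Set.Ioi 0)) (nhds (2 * L * ‖w‖ * (0 * V))) :=
    (hT2.mul_const V).const_mul _
  have hle := le_of_tendsto_of_tendsto hL hR (by
    filter_upwards [Ioo_mem_nhdsGT (zero_lt_one' ℝ)] with h hh
    exact abs_setIntegral_sub_le hf hd w hh.1 hh.2)
  rw [zero_mul, mul_zero] at hle
  exact sub_eq_zero.1 (abs_nonpos_iff.1 hle)

end Divergence
-- The mean of the gradient estimate and its bias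
section Smoothing

variable {d : ℕ}

theorem eq_zero_of_neg_eq {v : Vec d} (h : -v = v) : v = 0 := by
  have h2 : (2 : ℝ) • v = 0 := by rw [two_smul]; nth_rewrite 1 [← h]; exact neg_add_cancel v
  exact (smul_eq_zero.1 h2).resolve_left two_ne_zero

theorem inner_gradient {f : Vec d → ℝ} (x w : Vec d) :
    inner ℝ (gradient f x) w = fderiv ℝ f x w := by
  rw [gradient, InnerProductSpace.toDual_symm_apply]

theorem HasLipschitzHessian.continuous_gradient {f : Vec d → ℝ} {L_H : ℝ}
    (hf : HasLipschitzHessian f L_H) : Continuous (gradient f) := hf.2.1.continuous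

theorem HasLipschitzHessian.contDiff {f : Vec d → ℝ} {L_H : ℝ}
    (hf : HasLipschitzHessian f L_H) : ContDiff ℝ 1 f := by
  rw [contDiff_one_iff_fderiv]
  refine ⟨hf.1, ?_⟩
  have h : fderiv ℝ f = fun x => InnerProductSpace.toDual ℝ (Vec d) (gradient f x) := by
    ext x : 1
    simp [gradient]
  rw [h]
  exact (InnerProductSpace.toDual ℝ (Vec d)).continuous.comp hf.continuous_gradient

/-- Along the segment `y + s • z` the derivative of the remainder has norm at most `L_H * ‖z‖ ^ 2 *
s`; the mean value inequality compares the remainder with the primitive of this bound. -/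
theorem HasLipschitzHessian.norm_taylor_le {f : Vec d → ℝ} {L_H : ℝ}
    (hf : HasLipschitzHessian f L_H) (y z : Vec d) :
    ‖gradient f (y + z) - gradient f y - fderiv ℝ (gradient f) y z‖ ≤ L_H / 2 * ‖z‖ ^ 2 := by
  have hder : ∀ s : ℝ, HasDerivAt
      (fun s : ℝ => gradient f (y + s • z) - gradient f y - s • fderiv ℝ (gradient f) y z)
      (fderiv ℝ (gradient f) (y + s • z) z - fderiv ℝ (gradient f) y z) s := by
    intro s
    have h1 : HasDerivAt (fun s : ℝ => y + s • z) z s := by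
      simpa using ((hasDerivAt_id s).smul_const z).const_add y
    have h2 := (hf.2.1 (y + s • z)).hasFDerivAt.comp_hasDerivAt s h1
    have h3 : HasDerivAt (fun s : ℝ => s • fderiv ℝ (gradient f) y z)
        (fderiv ℝ (gradient f) y z) s := by
      simpa using (hasDerivAt_id s).smul_const (fderiv ℝ (gradient f) y z)
    exact (h2.sub_const _).sub h3
  have hB : ∀ s : ℝ, HasDerivAt (fun s : ℝ => L_H / 2 * ‖z‖ ^ 2 * s ^ 2)
      (L_H * ‖z‖ ^ 2 * s) s := by
    intro s
    have := (hasDerivAt_pow 2 s).const_mul (L_H / 2 * ‖z‖ ^ 2)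
    exact this.congr_deriv (by norm_num; ring)
  have := image_norm_le_of_norm_deriv_right_le_deriv_boundary (a := 0) (b := 1)
    (f := fun s : ℝ => gradient f (y + s • z) - gradient f y - s • fderiv ℝ (gradient f) y z)
    (fun s _ => (hder s).continuousAt.continuousWithinAt) (fun s _ => (hder s).hasDerivWithinAt)
    (by simp) hB (fun s hs => by
      rw [← sub_apply]
      refine (ContinuousLinearMap.le_opNorm _ _).trans ?_
      have h1 := hf.2.2 (y + s • z) y
      rw [add_sub_cancel_left, norm_smul, Real.norm_of_nonneg hs.1] at h1
      calc _ ≤ (L_H * (s * ‖z‖)) * ‖z‖ := by gcongr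
        _ = _ := by ring)
    (Set.right_mem_Icc.2 zero_le_one)
  simpa using this

/-- The mean of the zeroth-order gradient estimate at `y`. -/
noncomputable def meanEstimate (f : Vec d → ℝ) (δ : ℝ) (y : Vec d) : Vec d :=
  ∫ u, ((d : ℝ) / δ * f (y + δ • u)) • u ∂(unifSphere d)

theorem lipschitzWith_of_abs_sub_le {f : Vec d → ℝ} {L : ℝ} (hL : 0 ≤ L)
    (hf : ∀ x y, |f x - f y| ≤ L * ‖x - y‖) : LipschitzWith (Real.toNNReal L) f :=
  LipschitzWith.of_dist_le_mul fun x y => by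
    rw [Real.coe_toNNReal _ hL, Real.dist_eq, dist_eq_norm]; exact hf x y

theorem norm_gradient_le {f : Vec d → ℝ} {L : ℝ} (hL : 0 ≤ L)
    (hf : ∀ x y, |f x - f y| ≤ L * ‖x - y‖) (x : Vec d) : ‖gradient f x‖ ≤ L := by
  rw [gradient, LinearIsometryEquiv.norm_map]
  simpa [hL] using norm_fderiv_le_of_lipschitz ℝ (lipschitzWith_of_abs_sub_le hL hf) (x₀ := x)

variable [NeZero d]

theorem integrable_unifSphere_of_continuous {F : Type*} [NormedAddCommGroup F]
    [NormedSpace ℝ F] [SecondCountableTopologyEither (Vec d) F] {φ : Vec d → F}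
    (hφ : Continuous φ) : Integrable φ (unifSphere d) := by
  obtain ⟨C, hC⟩ := (isCompact_closedBall (0 : Vec d) 1).exists_bound_of_continuousOn
    hφ.continuousOn
  refine Integrable.of_bound hφ.aestronglyMeasurable C ?_
  filter_upwards [ae_norm_unifSphere] with u hu
  exact hC u (by simp [hu])

/-- This is the divergence theorem for `v ↦ f (y + δ • v)`, tested against each vector `w`; the
chain rule produces the factor `δ` that cancels the one in `d / δ`. -/
theorem meanEstimate_eq {f : Vec d → ℝ} {L δ : ℝ} (hL : 0 ≤ L) (hδ : 0 < δ)
    (hf : ∀ x y, |f x - f y| ≤ L * ‖x - y‖) (hc : ContDiff ℝ 1 f) (y : Vec d) :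
    meanEstimate f δ y = (volume.real (Metric.ball (0 : Vec d) 1))⁻¹ •
      ∫ v in Metric.ball (0 : Vec d) 1, gradient f (y + δ • v) := by
  have hgrad : Continuous (gradient f) :=
    (InnerProductSpace.toDual ℝ (Vec d)).symm.continuous.comp
      (hc.continuous_fderiv (by norm_num))
  have hfc := hc.continuous
  have hint : Integrable (fun u : Vec d => ((d : ℝ) / δ * f (y + δ • u)) • u) (unifSphere d) :=
    integrable_unifSphere_of_continuous (by fun_prop)
  have hint2 : IntegrableOn (fun v : Vec d => gradient f (y + δ • v)) (Metric.ball 0 1) :=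
    ((by fun_prop : Continuous (fun v : Vec d => gradient f (y + δ • v))).continuousOn
      |>.integrableOn_compact (isCompact_closedBall 0 1)).mono_set Metric.ball_subset_closedBall
  refine ext_inner_left ℝ fun w => ?_
  rw [meanEstimate, ← integral_inner hint, inner_smul_right, ← integral_inner hint2]
  have hlip : LipschitzWith (Real.toNNReal (L * δ)) (fun v : Vec d => f (y + δ • v)) :=
    lipschitzWith_of_abs_sub_le (by positivity) fun a b => (hf _ _).trans_eq (by
      rw [add_sub_add_left_eq_sub, ← smul_sub, norm_smul, Real.norm_of_nonneg hδ.le]; ring)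
  have hdiv := setIntegral_ball_fderiv hlip (by fun_prop) w
  have hfd : ∀ v, fderiv ℝ (fun v : Vec d => f (y + δ • v)) v w =
      δ * inner ℝ w (gradient f (y + δ • v)) := by
    intro v
    have h1 : HasFDerivAt (fun v : Vec d => y + δ • v) (δ • ContinuousLinearMap.id ℝ (Vec d)) v :=
      ((hasFDerivAt_id v).const_smul δ).const_add y
    have h2 := ((hc.differentiable (by norm_num)) (y + δ • v)).hasFDerivAt.comp v h1
    rw [show (fun v : Vec d => f (y + δ • v)) = f ∘ (fun v : Vec d => y + δ • v) from rfl,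
      h2.fderiv, real_inner_comm, inner_gradient]
    simp
  simp_rw [hfd] at hdiv
  rw [integral_const_mul] at hdiv
  rw [integral_unifSphere (Continuous.stronglyMeasurable (by fun_prop)), smul_eq_mul]
  congr 1
  have h3 : ∀ v : Vec d, inner ℝ w (((d : ℝ) / δ * f (y + δ • direction v)) • direction v) =
      (d : ℝ) / δ * (f (y + δ • direction v) * inner ℝ (direction v) w) := by
    intro v
    rw [inner_smul_right, real_inner_comm]; ring
  simp_rw [h3]
  rw [integral_const_mul, div_mul_eq_mul_div, ← hdiv]
  field_simp

/-- The Hessian term of the Taylor expansion at `y` is odd in `v` and integrates to zero over the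
ball, so only the quadratic remainder is left. Hence the bias is of order `δ ^ 2` rather than `δ`.
-/
theorem norm_meanEstimate_sub_gradient_le {f : Vec d → ℝ} {L L_H δ : ℝ} (hL : 0 ≤ L)
    (hL_H : 0 ≤ L_H) (hδ : 0 < δ) (hf : ∀ x y, |f x - f y| ≤ L * ‖x - y‖)
    (hH : HasLipschitzHessian f L_H) (y : Vec d) :
    ‖meanEstimate f δ y - gradient f y‖ ≤ L_H / 2 * δ ^ 2 := by
  set B := Metric.ball (0 : Vec d) 1 with hB
  have hgrad := hH.continuous_gradient
  have hic : ∀ {φ : Vec d → Vec d}, Continuous φ → IntegrableOn φ B := fun hφ =>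
    (hφ.continuousOn.integrableOn_compact (isCompact_closedBall 0 1)).mono_set
      Metric.ball_subset_closedBall
  have hlin : ∫ v in B, fderiv ℝ (gradient f) y (δ • v) = 0 := by
    have h := setIntegral_ball_neg (fun v : Vec d => fderiv ℝ (gradient f) y (δ • v))
    simp only [smul_neg, map_neg, integral_neg] at h
    exact eq_zero_of_neg_eq h
  have hT : meanEstimate f δ y - gradient f y = (volume.real B)⁻¹ • ∫ v in B,
      (gradient f (y + δ • v) - gradient f y - fderiv ℝ (gradient f) y (δ • v)) := by
    have i1 : IntegrableOn (fun v => gradient f (y + δ • v)) B := hic (by fun_prop)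
    have i2 : IntegrableOn (fun _ => gradient f y) B := hic (by fun_prop)
    have i3 : IntegrableOn (fun v => fderiv ℝ (gradient f) y (δ • v)) B := hic (by fun_prop)
    have i12 : IntegrableOn (fun v => gradient f (y + δ • v) - gradient f y) B := i1.sub i2
    rw [integral_sub i12 i3, hlin, sub_zero, integral_sub i1 i2, smul_sub,
      ← meanEstimate_eq hL hδ hf hH.contDiff]
    congr 1
    simp only [integral_const, measureReal_restrict_apply_univ, smul_smul]
    rw [inv_mul_cancel₀ volume_real_ball_pos.ne', one_smul]
  rw [hT, norm_smul, norm_inv, Real.norm_of_nonneg measureReal_nonneg,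
    inv_mul_le_iff₀ volume_real_ball_pos]
  refine (norm_setIntegral_le_of_norm_le_const (C := L_H / 2 * δ ^ 2) measure_ball_lt_top
    fun v hv => ?_).trans_eq (mul_comm _ _)
  refine (hH.norm_taylor_le y (δ • v)).trans ?_
  have hv1 : ‖v‖ < 1 := by simpa [hB] using hv
  rw [norm_smul, Real.norm_of_nonneg hδ.le]
  have : δ * ‖v‖ ≤ δ := mul_le_of_le_one_right hδ.le hv1.le
  gcongr

theorem integral_id_unifSphere : ∫ u, u ∂(unifSphere d) = 0 := by
  have h := integral_unifSphere_neg (d := d) (φ := fun u => u) stronglyMeasurable_id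
  rw [integral_neg] at h
  exact eq_zero_of_neg_eq h

/-- The sphere has mean zero, so `f y` may be subtracted from the values of `f`; the Lipschitz bound
then cancels `δ`. -/
theorem norm_meanEstimate_le {f : Vec d → ℝ} {L δ : ℝ} (hδ : 0 < δ)
    (hf : ∀ x y, |f x - f y| ≤ L * ‖x - y‖) (hc : Continuous f) (y : Vec d) :
    ‖meanEstimate f δ y‖ ≤ d * L := by
  have h : meanEstimate f δ y =
      ∫ u, ((d : ℝ) / δ * (f (y + δ • u) - f y)) • u ∂(unifSphere d) := by
    have h1 : Integrable (fun u : Vec d => ((d : ℝ) / δ * f (y + δ • u)) • u) (unifSphere d) :=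
      integrable_unifSphere_of_continuous (by fun_prop)
    have h2 : Integrable (fun u : Vec d => ((d : ℝ) / δ * f y) • u) (unifSphere d) :=
      integrable_unifSphere_of_continuous (by fun_prop)
    simp_rw [mul_sub, sub_smul]
    rw [integral_sub h1 h2, integral_smul, integral_id_unifSphere, smul_zero, sub_zero]
    rfl
  rw [h]
  refine (norm_integral_le_of_norm_le_const (C := d * L) ?_).trans_eq (by simp)
  filter_upwards [ae_norm_unifSphere] with u hu
  have h3 := hf (y + δ • u) y
  rw [add_sub_cancel_left, norm_smul, hu, Real.norm_of_nonneg hδ.le, mul_one] at h3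
  rw [norm_smul, hu, mul_one, norm_mul, Real.norm_eq_abs, Real.norm_eq_abs,
    abs_of_nonneg (by positivity)]
  calc (d : ℝ) / δ * |f (y + δ • u) - f y| ≤ (d : ℝ) / δ * (L * δ) := by gcongr
    _ = d * L := by field_simp

theorem meanEstimate_eq_twoPoint {f : Vec d → ℝ} (hf : Continuous f) (δ : ℝ) (y : Vec d) :
    ∫ u, ((d : ℝ) / (2 * δ) * (f (y + δ • u) - f (y - δ • u))) • u ∂(unifSphere d) =
      meanEstimate f δ y := by
  have hi : ∀ {φ : Vec d → Vec d}, Continuous φ → Integrable φ (unifSphere d) :=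
    integrable_unifSphere_of_continuous
  have h1 : ∀ u : Vec d, ((d : ℝ) / (2 * δ) * (f (y + δ • u) - f (y - δ • u))) • u =
      (1 / 2 : ℝ) • (((d : ℝ) / δ * f (y + δ • u)) • u) +
      (1 / 2 : ℝ) • (((d : ℝ) / δ * f (y + δ • (-u))) • (-u)) := by
    intro u
    rw [smul_neg δ u, ← sub_eq_add_neg y, smul_neg, smul_neg, smul_smul, smul_smul,
      ← sub_eq_add_neg, ← sub_smul]
    congr 1
    rw [mul_comm 2 δ, ← div_div]; ring
  simp_rw [h1]
  rw [integral_add (hi (by fun_prop)) (hi (by fun_prop)), integral_smul, integral_smul,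
    integral_unifSphere_neg (φ := fun u : Vec d => ((d : ℝ) / δ * f (y + δ • u)) • u)
      (Continuous.stronglyMeasurable (by fun_prop)), ← add_smul]
  norm_num [meanEstimate]

theorem stronglyMeasurable_meanEstimate {f : Vec d → ℝ} (hf : Continuous f) (δ : ℝ) :
    StronglyMeasurable (meanEstimate f δ) := by
  unfold meanEstimate
  refine StronglyMeasurable.integral_prod_right (f := fun y u : Vec d =>
    ((d : ℝ) / δ * f (y + δ • u)) • u) ?_
  exact Continuous.stronglyMeasurable (by fun_prop)

end Smoothing
-- Deterministic estimates: regret in a block and gradient at an average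
section Deterministic

variable {d : ℕ}

theorem norm_projBall_le {D : ℝ} (hD : 0 ≤ D) (v : Vec d) : ‖projBall D v‖ ≤ D := by
  simpa using (projBall_isProjection hD v).1

theorem norm_projBall_sub_le {D : ℝ} (hD : 0 ≤ D) (v w : Vec d) (hw : ‖w‖ ≤ D) :
    ‖projBall D v - w‖ ≤ ‖v - w‖ := by
  unfold projBall
  split_ifs with h
  · rfl
  · push Not at h
    have hv : 0 < ‖v‖ := hD.trans_lt h
    set a := D / ‖v‖ with ha
    have ha0 : 0 ≤ a := by positivity
    have ha1 : a ≤ 1 := (div_le_one hv).2 h.le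
    have haD : a * ‖v‖ = D := div_mul_cancel₀ _ hv.ne'
    have hin : inner ℝ v w ≤ a * ‖v‖ ^ 2 := by
      calc inner ℝ v w ≤ ‖v‖ * ‖w‖ := real_inner_le_norm v w
        _ ≤ ‖v‖ * D := by gcongr
        _ = a * ‖v‖ ^ 2 := by rw [← haD]; ring
    refine (sq_le_sq₀ (norm_nonneg _) (norm_nonneg _)).1 ?_
    rw [norm_sub_sq_real, norm_sub_sq_real, norm_smul, Real.norm_of_nonneg ha0,
      real_inner_smul_left]
    -- The difference of the squared distances is (1 - a)²‖v‖² + 2(1 - a)(a‖v‖² - ⟨v, w⟩).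
    nlinarith [mul_nonneg (sub_nonneg.2 ha1) (sub_nonneg.2 hin),
      mul_nonneg (sub_nonneg.2 ha1) (mul_nonneg (sub_nonneg.2 ha1) (sq_nonneg ‖v‖))]

/-- Regret of online projected gradient descent. -/
theorem sum_inner_sub_le {D η : ℝ} (hD : 0 ≤ D) (hη : 0 < η) {M : ℕ} {Δ g : ℕ → Vec d}
    (h0 : Δ 0 = 0) (hΔ : ∀ m, m + 1 < M → Δ (m + 1) = projBall D (Δ m - η • g m))
    {w : Vec d} (hw : ‖w‖ ≤ D) :
    ∑ m ∈ Finset.range M, inner ℝ (g m) (Δ m - w) ≤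
      D ^ 2 / (2 * η) + η / 2 * ∑ m ∈ Finset.range M, ‖g m‖ ^ 2 := by
  have hstep : ∀ m, inner ℝ (g m) (Δ m - w) + ‖Δ m - η • g m - w‖ ^ 2 / (2 * η) =
      ‖Δ m - w‖ ^ 2 / (2 * η) + η / 2 * ‖g m‖ ^ 2 := by
    intro m
    have h1 : Δ m - η • g m - w = (Δ m - w) - η • g m := by abel
    rw [h1, norm_sub_sq_real, inner_smul_right, norm_smul, Real.norm_of_nonneg hη.le,
      real_inner_comm]
    field_simp
    ring
  -- The potential is ‖Δ n - w‖² / (2η): `hstep` is its exact change under a gradient step, and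
  -- projection does not increase it.
  have hpot : ∀ n, n < M → ∑ m ∈ Finset.range n, inner ℝ (g m) (Δ m - w) +
      ‖Δ n - w‖ ^ 2 / (2 * η) ≤
      D ^ 2 / (2 * η) + η / 2 * ∑ m ∈ Finset.range n, ‖g m‖ ^ 2 := by
    intro n
    induction n with
    | zero =>
      intro _
      simp only [Finset.range_zero, Finset.sum_empty, h0, zero_sub, norm_neg]
      have : ‖w‖ ^ 2 ≤ D ^ 2 := by gcongr
      have : ‖w‖ ^ 2 / (2 * η) ≤ D ^ 2 / (2 * η) := by gcongr
      linarith
    | succ n ih =>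
      intro hn
      have h1 := ih (by omega)
      have h2 := hstep n
      have h3 : ‖Δ (n + 1) - w‖ ^ 2 / (2 * η) ≤ ‖Δ n - η • g n - w‖ ^ 2 / (2 * η) := by
        rw [hΔ n hn]
        gcongr
        exact norm_projBall_sub_le hD _ _ hw
      rw [Finset.sum_range_succ, Finset.sum_range_succ]
      linarith
  -- No update is assumed after the last step, since `Δ` is then reset for the next block. The last
  -- term therefore uses `hstep` alone, and its nonnegative final potential is dropped.
  rcases M with _ | n
  · simp; positivity
  · have h1 := hpot n (by omega)
    have h2 := hstep n
    have h3 : 0 ≤ ‖Δ n - η • g n - w‖ ^ 2 / (2 * η) := by positivity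
    rw [Finset.sum_range_succ, Finset.sum_range_succ]
    linarith

/-- Regret against the comparator `-D A / ‖A‖`, where `A = ∑ a m`. -/
theorem mul_norm_sum_le {D η b : ℝ} (hD : 0 ≤ D) (hη : 0 < η) {M : ℕ}
    {Δ g a μ : ℕ → Vec d}
    (h0 : Δ 0 = 0) (hΔ : ∀ m, m + 1 < M → Δ (m + 1) = projBall D (Δ m - η • g m))
    (hb : ∀ m, ‖μ m - a m‖ ≤ b) :
    D * ‖∑ m ∈ Finset.range M, a m‖ ≤
      -∑ m ∈ Finset.range M, inner ℝ (g m) (Δ m) + D * (M * b) +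
        D * ‖∑ m ∈ Finset.range M, (g m - μ m)‖ + D ^ 2 / (2 * η) +
        η / 2 * ∑ m ∈ Finset.range M, ‖g m‖ ^ 2 := by
  set A := ∑ m ∈ Finset.range M, a m
  set S := ∑ m ∈ Finset.range M, (g m - μ m)
  set N := ∑ m ∈ Finset.range M, (μ m - a m)
  have hw : ‖(-D) • direction A‖ ≤ D := by
    rw [norm_smul, norm_neg, Real.norm_of_nonneg hD]
    exact mul_le_of_le_one_right hD (norm_direction_le A)
  have h1 := sum_inner_sub_le hD hη h0 hΔ hw
  simp only [inner_sub_right, Finset.sum_sub_distrib, ← sum_inner] at h1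
  -- The estimates split into true gradients `A`, noise `S` and bias `N`. Paired with the
  -- comparator, `A` yields -D‖A‖, and the other two cost at most `D` times their norms.
  have hsum : ∑ m ∈ Finset.range M, g m = A + S + N := by
    simp only [A, S, N, ← Finset.sum_add_distrib]
    refine Finset.sum_congr rfl fun m _ => by abel
  have hA : inner ℝ A ((-D) • direction A) = -(D * ‖A‖) := by
    rw [direction, smul_smul, inner_smul_right, real_inner_self_eq_norm_sq]
    rcases eq_or_ne ‖A‖ 0 with h | h
    · simp [h]
    · field_simp
  have hN : ‖N‖ ≤ M * b := by
    calc ‖N‖ ≤ ∑ m ∈ Finset.range M, ‖μ m - a m‖ := norm_sum_le _ _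
      _ ≤ ∑ m ∈ Finset.range M, b := Finset.sum_le_sum fun m _ => hb m
      _ = M * b := by simp
  have hin : ∀ v : Vec d, inner ℝ v ((-D) • direction A) ≤ D * ‖v‖ := fun v =>
    (real_inner_le_norm _ _).trans (by rw [mul_comm]; gcongr)
  rw [hsum, inner_add_left, inner_add_left, hA] at h1
  have h2 := hin S
  have h3 := hin N
  have h4 : D * ‖N‖ ≤ D * (M * b) := by gcongr
  linarith

/-- The path from `y i` goes through `x (i + 1)` and `x j` to `y j`, in `j - i + 1 ≤ M` pieces of
length at most `D`. Starting through `x i` instead could take `M + 1` pieces. -/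
theorem norm_sub_le_of_steps {D : ℝ} {M : ℕ} {x y : ℕ → Vec d}
    (hx : ∀ m, m < M → ‖x (m + 1) - x m‖ ≤ D) (hy : ∀ m, m < M → ‖y m - x m‖ ≤ D)
    (hy' : ∀ m, m < M → ‖x (m + 1) - y m‖ ≤ D) {i j : ℕ} (hij : i < j) (hj : j < M) :
    ‖y j - y i‖ ≤ M * D := by
  have hD : 0 ≤ D := (norm_nonneg _).trans (hx j hj)
  have h : ∀ n, i + 1 + n ≤ M → ‖x (i + 1 + n) - x (i + 1)‖ ≤ n * D := by
    intro n
    induction n with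
    | zero => simp
    | succ n ih =>
      intro hn
      have h1 := ih (by omega)
      have h2 := hx (i + 1 + n) (by omega)
      have h3 := norm_add_le (x (i + 1 + n + 1) - x (i + 1 + n)) (x (i + 1 + n) - x (i + 1))
      rw [sub_add_sub_cancel] at h3
      push_cast
      rw [← add_assoc]
      linarith
  obtain ⟨n, rfl⟩ := Nat.exists_eq_add_of_le (show i + 1 ≤ j from hij)
  have h1 := h n hj.le
  have h2 := hy (i + 1 + n) hj
  have h3 := hy' i (by omega)
  have h4 : y (i + 1 + n) - y i = (y (i + 1 + n) - x (i + 1 + n)) +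
      (x (i + 1 + n) - x (i + 1)) + (x (i + 1) - y i) := by abel
  have h5 : ((n : ℝ) + 2) * D ≤ M * D := by
    gcongr
    exact_mod_cast (by omega : n + 2 ≤ M)
  rw [h4]
  refine (norm_add₃_le).trans ?_
  linarith

/-- In the Taylor expansion of the gradient about the average, the linear terms sum to zero, and
each point is within `r` of the average. -/
theorem norm_gradient_average_le {f : Vec d → ℝ} {L_H r : ℝ} (hL_H : 0 ≤ L_H)
    (hf : HasLipschitzHessian f L_H) {M : ℕ} (hM : 0 < M) {y : ℕ → Vec d}
    (hy : ∀ i < M, ∀ j < M, ‖y j - y i‖ ≤ r) :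
    ‖gradient f ((M : ℝ)⁻¹ • ∑ m ∈ Finset.range M, y m)‖ ≤
      (M : ℝ)⁻¹ * ‖∑ m ∈ Finset.range M, gradient f (y m)‖ + L_H / 2 * r ^ 2 := by
  have hMr : (0 : ℝ) < M := by exact_mod_cast hM
  set z := (M : ℝ)⁻¹ • ∑ m ∈ Finset.range M, y m with hz
  have hMz : (M : ℝ) • z = ∑ m ∈ Finset.range M, y m := by
    rw [hz, smul_smul, mul_inv_cancel₀ hMr.ne', one_smul]
  have hdist : ∀ i < M, ‖y i - z‖ ≤ r := by
    intro i hi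
    have h1 : (M : ℝ) • (y i - z) = ∑ m ∈ Finset.range M, (y i - y m) := by
      rw [smul_sub, hMz, Finset.sum_sub_distrib]
      simp [Nat.cast_smul_eq_nsmul]
    have h2 : ‖(M : ℝ) • (y i - z)‖ ≤ M * r := by
      rw [h1]
      refine (norm_sum_le _ _).trans ((Finset.sum_le_sum (g := fun _ => r) fun m hm => ?_).trans_eq
        (by simp))
      exact hy m (Finset.mem_range.1 hm) i hi
    rw [norm_smul, Real.norm_of_nonneg hMr.le] at h2
    exact le_of_mul_le_mul_left h2 hMr
  have hlin : ∑ m ∈ Finset.range M, fderiv ℝ (gradient f) z (y m - z) = 0 := by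
    rw [← map_sum, Finset.sum_sub_distrib, ← hMz]
    simp [Nat.cast_smul_eq_nsmul]
  have hT : (M : ℝ) • gradient f z = ∑ m ∈ Finset.range M, gradient f (y m) -
      ∑ m ∈ Finset.range M,
        (gradient f (z + (y m - z)) - gradient f z - fderiv ℝ (gradient f) z (y m - z)) := by
    rw [Finset.sum_sub_distrib, hlin, sub_zero, Finset.sum_sub_distrib]
    simp [Nat.cast_smul_eq_nsmul]
  have hbd : ‖(M : ℝ) • gradient f z‖ ≤ ‖∑ m ∈ Finset.range M, gradient f (y m)‖ +
      M * (L_H / 2 * r ^ 2) := by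
    rw [hT]
    refine (norm_sub_le _ _).trans ?_
    gcongr
    refine (norm_sum_le _ _).trans ((Finset.sum_le_sum (g := fun _ => L_H / 2 * r ^ 2)
      fun m hm => ?_).trans_eq (by simp))
    refine (hf.norm_taylor_le z _).trans ?_
    have := hdist m (Finset.mem_range.1 hm)
    gcongr
  rw [norm_smul, Real.norm_of_nonneg hMr.le] at hbd
  rw [← mul_le_mul_iff_right₀ hMr, mul_add, ← mul_assoc, mul_inv_cancel₀ hMr.ne', one_mul]
  exact hbd

end Deterministic
-- A common description of one iteration for both options
section Step

variable {d : ℕ} {Z : Type*} [MeasurableSpace Z] (P : Problem d Z)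

theorem Problem.call_apply {A : Type*} [MeasurableSpace A] (q : A → Vec d) (hq : Measurable q)
    (a : A × ℕ) :
    P.call q hq a = (P.szo (q a.1)).map (fun h => ((a.1, h), a.2 + 1)) := by
  have : P.szo.comap (fun a : A × ℕ => q a.1) (by fun_prop) a = P.szo (q a.1) := rfl
  ext s hs
  rw [Problem.call, Kernel.map_apply' _ (by fun_prop) _ hs, Kernel.prod_apply, Kernel.id_apply,
    Measure.dirac_prod, this, Measure.map_apply (by fun_prop) (by measurability),
    Measure.map_apply (by fun_prop) hs]
  rfl

theorem Problem.lintegral_call {A : Type*} [MeasurableSpace A] (q : A → Vec d)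
    (hq : Measurable q) (a : A × ℕ) {φ : (A × ℝ) × ℕ → ENNReal} (hφ : Measurable φ) :
    ∫⁻ z, φ z ∂(P.call q hq a) = ∫⁻ h, φ ((a.1, h), a.2 + 1) ∂(P.szo (q a.1)) := by
  rw [P.call_apply, lintegral_map hφ (by fun_prop)]

theorem draw_apply [NeZero d] (c : Iterate d) :
    draw d c = (unifInterval.prod (unifSphere d)).map (fun w => ((c.1, w), c.2)) := by
  ext s hs
  rw [draw, Kernel.map_apply' _ (by fun_prop) _ hs, Kernel.prod_apply, Kernel.id_apply,
    Measure.dirac_prod, Kernel.const_apply, Measure.map_apply (by fun_prop) (by measurability),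
    Measure.map_apply (by fun_prop) hs]
  rfl

theorem lintegral_draw [NeZero d] (c : Iterate d) {φ : Drawn d × ℕ → ENNReal}
    (hφ : Measurable φ) :
    ∫⁻ z, φ z ∂(draw d c) =
      ∫⁻ w, φ ((c.1, w), c.2) ∂(unifInterval.prod (unifSphere d)) := by
  rw [draw_apply, lintegral_map hφ (by fun_prop)]

variable (o : Feedback) (p : Params) (n : ℕ)

/-- The two values whose difference enters the gradient estimate, given the current data and the
draws `(s, u)`: two fresh answers in Option I; a fresh answer and the last one in Option II. -/
noncomputable def answers (c : Core d) : Kernel (ℝ × Vec d) (ℝ × ℝ) :=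
  (P.szo.comap (fun w => queryPlus p n (c, w)) (by fun_prop)) ×ₖ
    match o with
    | .twoPoint => P.szo.comap (fun w => queryMinus p n (c, w)) (by fun_prop)
    | .onePoint => Kernel.const _ (Measure.dirac c.h)

instance (c : Core d) : IsMarkovKernel (answers P o p n c) := by
  cases o <;> unfold answers <;> infer_instance

/-- The scalar factor of the gradient estimate. -/
noncomputable def Feedback.factor (o : Feedback) (d : ℕ) (δ : ℝ) : ℝ :=
  match o with
  | .twoPoint => (d : ℝ) / (2 * δ)
  | .onePoint => (d : ℝ) / δ

/-- The number of oracle calls in an iteration. -/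
def Feedback.cost : Feedback → ℕ
  | .twoPoint => 2
  | .onePoint => 1

/-- The last of the answers obtained in an iteration. -/
def Feedback.last : Feedback → ℝ × ℝ → ℝ
  | .twoPoint, h => h.2
  | .onePoint, h => h.1

@[fun_prop]
theorem Feedback.measurable_last : Measurable o.last := by
  cases o
  · exact measurable_snd
  · exact measurable_fst

/-- The data after iteration `n + 1` as a function of the draws and the answers. -/
noncomputable def nextIterate (c : Iterate d) (w : (ℝ × Vec d) × (ℝ × ℝ)) : Iterate d :=
  (finish p n (c.1, w.1) ((o.factor d p.δ * (w.2.1 - w.2.2)) • w.1.2) (o.last w.2), c.2 + o.cost)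

@[fun_prop]
theorem measurable_nextIterate (c : Iterate d) : Measurable (nextIterate o p n c) := by
  unfold nextIterate finish
  fun_prop

variable [NeZero d]

/-- The joint law of the draws and the answers in iteration `n + 1`. -/
noncomputable def stepLaw (c : Core d) : Measure ((ℝ × Vec d) × (ℝ × ℝ)) :=
  (unifInterval.prod (unifSphere d)) ⊗ₘ answers P o p n c

instance (c : Core d) : IsProbabilityMeasure (stepLaw P o p n c) := by
  unfold stepLaw; infer_instance

/-- Both sides integrate nonnegative functions in the same way, by Tonelli. In this form the options
differ only in the second value, the scalar factor, the answer kept and the cost, so moments and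
means can be computed on `stepLaw`. -/
theorem step_apply (c : Iterate d) :
    step P o p n c = (stepLaw P o p n c.1).map (nextIterate o p n c) := by
  refine Measure.ext_of_lintegral _ fun φ hφ => ?_
  rw [lintegral_map hφ (by fun_prop), stepLaw,
    Measure.lintegral_compProd (f := fun w => φ (nextIterate o p n c w)) (by fun_prop)]
  cases o
  · rw [step, Kernel.lintegral_map _ (by fun_prop) _ hφ, Kernel.lintegral_comp _ _ _ (by fun_prop),
      lintegral_draw _ (by fun_prop)]
    refine lintegral_congr fun w => ?_
    rw [Kernel.lintegral_comp _ _ _ (by fun_prop), P.lintegral_call _ _ _ (by fun_prop), answers, Kernel.prod_apply,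
      lintegral_prod _ (by fun_prop)]
    refine lintegral_congr fun h => ?_
    rw [P.lintegral_call _ _ _ (by fun_prop)]
    rfl
  · rw [step, Kernel.lintegral_map _ (by fun_prop) _ hφ, Kernel.lintegral_comp _ _ _ (by fun_prop),
      lintegral_draw _ (by fun_prop)]
    refine lintegral_congr fun w => ?_
    rw [P.lintegral_call _ _ _ (by fun_prop), answers, Kernel.prod_apply,
      lintegral_prod _ (by fun_prop)]
    refine lintegral_congr fun h => ?_
    rw [Kernel.const_apply, lintegral_dirac' _ (by fun_prop)]
    rfl

end Step
-- Moments of one oracle answer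
section Oracle

variable {d : ℕ} {Z : Type*} [MeasurableSpace Z] {P : Problem d Z} {σ L : ℝ}

theorem Problem.NoiseBound.integrable_szo (hN : P.NoiseBound σ) (x : Vec d) :
    Integrable (fun h => h) (P.szo x) := by
  have hm : Measurable (P.F x) := P.measurable_F.of_uncurry_left
  rw [P.szo_apply]
  refine (integrable_map_measure (by fun_prop) hm.aemeasurable).2 ?_
  exact (hN x).1.integrable (by norm_num)

theorem Problem.integral_szo (x : Vec d) : ∫ h, h ∂(P.szo x) = P.objective x := by
  have hm : Measurable (P.F x) := P.measurable_F.of_uncurry_left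
  rw [P.szo_apply, integral_map hm.aemeasurable (by fun_prop), Problem.objective]

theorem Problem.NoiseBound.lintegral_szo_sub_sq_le (hN : P.NoiseBound σ) (x : Vec d) {a r : ℝ}
    (ha : |P.objective x - a| ≤ r) :
    ∫⁻ h, ENNReal.ofReal ((h - a) ^ 2) ∂(P.szo x) ≤ ENNReal.ofReal (2 * σ ^ 2 + 2 * r ^ 2) := by
  have hm : Measurable (P.F x) := P.measurable_F.of_uncurry_left
  have hr : (P.objective x - a) ^ 2 ≤ r ^ 2 := sq_le_sq' (abs_le.1 ha).1 (abs_le.1 ha).2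
  have hi : Integrable (fun ξ => (P.F x ξ - P.objective x) ^ 2) (P.law x) :=
    ((hN x).1.sub (memLp_const _)).integrable_sq
  have hs : ∫ ξ, (P.F x ξ - P.objective x) ^ 2 ∂(P.law x) ≤ σ ^ 2 := by
    simpa only [sq_abs] using (hN x).2
  have hi2 : Integrable (fun ξ => 2 * (P.F x ξ - P.objective x) ^ 2 + 2 * r ^ 2) (P.law x) :=
    (hi.const_mul 2).add (integrable_const _)
  rw [P.szo_apply, lintegral_map (by fun_prop) hm]
  calc ∫⁻ ξ, ENNReal.ofReal ((P.F x ξ - a) ^ 2) ∂(P.law x)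
      ≤ ∫⁻ ξ, ENNReal.ofReal (2 * (P.F x ξ - P.objective x) ^ 2 + 2 * r ^ 2) ∂(P.law x) := by
        refine lintegral_mono fun ξ => ENNReal.ofReal_le_ofReal ?_
        nlinarith [sq_nonneg (P.F x ξ - P.objective x - (P.objective x - a))]
    _ = ENNReal.ofReal (∫ ξ, 2 * (P.F x ξ - P.objective x) ^ 2 + 2 * r ^ 2 ∂(P.law x)) := by
        rw [ofReal_integral_eq_lintegral_ofReal hi2
          (Filter.Eventually.of_forall fun ξ => by positivity)]
    _ ≤ _ := by
        refine ENNReal.ofReal_le_ofReal ?_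
        rw [integral_add (hi.const_mul 2) (integrable_const _), integral_const_mul]
        simp only [integral_const, probReal_univ, one_smul]
        linarith

end Oracle

/-! ### Second moments within one iteration -/

section StepMoments

variable {d : ℕ} {Z : Type*} [MeasurableSpace Z] {P : Problem d Z} {σ L : ℝ}
  (o : Feedback) (p : Params) (n : ℕ)

theorem ae_unif [NeZero d] : ∀ᵐ w ∂(unifInterval.prod (unifSphere d)),
    (0 ≤ w.1 ∧ w.1 ≤ 1) ∧ ‖w.2‖ = 1 := by
  have h1 : ∀ᵐ s ∂unifInterval, 0 ≤ s ∧ s ≤ 1 := ae_restrict_mem measurableSet_Icc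
  exact (Measure.quasiMeasurePreserving_fst.ae h1).and
    (Measure.quasiMeasurePreserving_snd.ae (ae_norm_unifSphere (d := d)))

theorem ae_stepLaw [NeZero d] (P : Problem d Z) (c : Core d) : ∀ᵐ w ∂(stepLaw P o p n c),
    (0 ≤ w.1.1 ∧ w.1.1 ≤ 1) ∧ ‖w.1.2‖ = 1 := by
  have h : (stepLaw P o p n c).map Prod.fst = unifInterval.prod (unifSphere d) :=
    Measure.fst_compProd _ _
  refine ae_of_ae_map (f := Prod.fst) (p := fun w : ℝ × Vec d => (0 ≤ w.1 ∧ w.1 ≤ 1) ∧ ‖w.2‖ = 1)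
    (by fun_prop) ?_
  rw [h]
  exact ae_unif

theorem integral_stepLaw_fst [NeZero d] {F : Type*} [NormedAddCommGroup F] [NormedSpace ℝ F]
    (P : Problem d Z) (c : Core d) {φ : ℝ → F} (hφ : StronglyMeasurable φ) :
    ∫ w, φ w.1.1 ∂(stepLaw P o p n c) = ∫ s in (0 : ℝ)..1, φ s := by
  have h : (stepLaw P o p n c).map Prod.fst = unifInterval.prod (unifSphere d) :=
    Measure.fst_compProd _ _
  have h2 : (unifInterval.prod (unifSphere d)).map Prod.fst = unifInterval := by
    simp [Measure.map_fst_prod]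
  rw [← integral_map (φ := fun w : (ℝ × Vec d) × (ℝ × ℝ) => w.1) (f := fun w => φ w.1)
    (by fun_prop) (hφ.comp_measurable measurable_fst).aestronglyMeasurable, h,
    ← integral_map (φ := Prod.fst) (f := φ) (by fun_prop) hφ.aestronglyMeasurable, h2,
    intervalIntegral.integral_of_le zero_le_one, unifInterval, integral_Icc_eq_integral_Ioc]

/-- Bound on the second moment of an answer around the objective at the base point. -/
noncomputable def answerBound (σ L δ : ℝ) : ℝ := 2 * σ ^ 2 + 2 * (L * δ) ^ 2

theorem answerBound_nonneg (σ L δ : ℝ) : 0 ≤ answerBound σ L δ := by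
  unfold answerBound; positivity

variable {p}

theorem lintegral_queryPlus_le (hN : P.NoiseBound σ) (hδ : 0 ≤ p.δ)
    (hf : ∀ x y, |P.objective x - P.objective y| ≤ L * ‖x - y‖) (a : Drawn d)
    (ha : ‖a.2.2‖ = 1) :
    ∫⁻ h, ENNReal.ofReal ((h - P.objective (nextY p n a)) ^ 2) ∂(P.szo (queryPlus p n a)) ≤
      ENNReal.ofReal (answerBound σ L p.δ) := by
  refine hN.lintegral_szo_sub_sq_le _ ((hf _ _).trans_eq ?_)
  rw [queryPlus, add_sub_cancel_left, norm_smul, ha, Real.norm_of_nonneg hδ, mul_one]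

theorem lintegral_queryMinus_le (hN : P.NoiseBound σ) (hδ : 0 ≤ p.δ)
    (hf : ∀ x y, |P.objective x - P.objective y| ≤ L * ‖x - y‖) (a : Drawn d)
    (ha : ‖a.2.2‖ = 1) :
    ∫⁻ h, ENNReal.ofReal ((h - P.objective (nextY p n a)) ^ 2) ∂(P.szo (queryMinus p n a)) ≤
      ENNReal.ofReal (answerBound σ L p.δ) := by
  refine hN.lintegral_szo_sub_sq_le _ ((hf _ _).trans_eq ?_)
  rw [queryMinus, sub_sub_cancel_left, norm_neg, norm_smul, ha, Real.norm_of_nonneg hδ, mul_one]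

theorem lintegral_answers_fst (P : Problem d Z) (c : Core d) (w : ℝ × Vec d) {φ : ℝ → ENNReal}
    (hφ : Measurable φ) :
    ∫⁻ h, φ h.1 ∂(answers P o p n c w) = ∫⁻ h, φ h ∂(P.szo (queryPlus p n (c, w))) := by
  cases o <;> rw [answers, Kernel.prod_apply, lintegral_prod _ (by fun_prop)] <;> simp

theorem lintegral_answers_snd_twoPoint (P : Problem d Z) (c : Core d) (w : ℝ × Vec d)
    {φ : ℝ → ENNReal} (hφ : Measurable φ) :
    ∫⁻ h, φ h.2 ∂(answers P .twoPoint p n c w) =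
      ∫⁻ h, φ h ∂(P.szo (queryMinus p n (c, w))) := by
  rw [answers, Kernel.prod_apply, lintegral_prod _ (by fun_prop)]
  simp

theorem lintegral_answers_snd_onePoint (P : Problem d Z) (c : Core d) (w : ℝ × Vec d)
    {φ : ℝ → ENNReal} (hφ : Measurable φ) :
    ∫⁻ h, φ h.2 ∂(answers P .onePoint p n c w) = φ c.h := by
  rw [answers, Kernel.prod_apply, lintegral_prod _ (by fun_prop)]
  simp [lintegral_dirac' _ hφ]

theorem lintegral_stepLaw_last_le [NeZero d] (hN : P.NoiseBound σ) (hδ : 0 ≤ p.δ)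
    (hf : ∀ x y, |P.objective x - P.objective y| ≤ L * ‖x - y‖) (hfc : Continuous P.objective)
    (c : Core d) :
    ∫⁻ w, ENNReal.ofReal ((o.last w.2 - P.objective (nextY p n (c, w.1))) ^ 2)
      ∂(stepLaw P o p n c) ≤ ENNReal.ofReal (answerBound σ L p.δ) := by
  have hfm := hfc.measurable
  rw [stepLaw, Measure.lintegral_compProd (by fun_prop)]
  calc _ ≤ ∫⁻ _, ENNReal.ofReal (answerBound σ L p.δ) ∂(unifInterval.prod (unifSphere d)) := by
        refine lintegral_mono_ae ?_
        filter_upwards [ae_unif (d := d)] with w hw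
        cases o
        · exact (lintegral_answers_snd_twoPoint n P c w
            (φ := fun h => ENNReal.ofReal ((h - P.objective (nextY p n (c, w))) ^ 2))
            (by fun_prop)).trans_le (lintegral_queryMinus_le n hN hδ hf (c, w) hw.2)
        · exact (lintegral_answers_fst .onePoint n P c w
            (φ := fun h => ENNReal.ofReal ((h - P.objective (nextY p n (c, w))) ^ 2))
            (by fun_prop)).trans_le (lintegral_queryPlus_le n hN hδ hf (c, w) hw.2)
    _ = _ := by simp

/-- The data satisfy the distance bounds that hold along every run. -/
def Core.Near (D : ℝ) (c : Core d) : Prop := ‖c.x - c.y‖ ≤ D ∧ ‖c.Δ‖ ≤ D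

theorem Core.Near.norm_currentΔ_le {D : ℝ} (hD : 0 ≤ D) {c : Core d} (hc : c.Near D) :
    ‖currentΔ p n c‖ ≤ D := by
  unfold currentΔ
  split_ifs
  · simpa using hD
  · exact hc.2

theorem norm_nextY_sub_x_le (a : Drawn d) (hs : 0 ≤ a.2.1 ∧ a.2.1 ≤ 1) :
    ‖nextY p n a - a.1.x‖ ≤ ‖currentΔ p n a.1‖ := by
  rw [nextY, add_sub_cancel_left, norm_smul, Real.norm_of_nonneg hs.1]
  exact mul_le_of_le_one_left (norm_nonneg _) hs.2

theorem norm_nextX_sub_nextY_le (a : Drawn d) (hs : 0 ≤ a.2.1 ∧ a.2.1 ≤ 1) :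
    ‖nextX p n a - nextY p n a‖ ≤ ‖currentΔ p n a.1‖ := by
  have : nextX p n a - nextY p n a = (1 - a.2.1) • currentΔ p n a.1 := by
    rw [nextX, nextY, sub_smul, one_smul]; abel
  rw [this, norm_smul, Real.norm_of_nonneg (by linarith)]
  exact mul_le_of_le_one_left (norm_nonneg _) (by linarith)

/-- The squared error of the last answer, as far as the next gradient estimate uses it. -/
noncomputable def Feedback.carriedError (o : Feedback) (f : Vec d → ℝ) (c : Core d) : ℝ :=
  match o with
  | .twoPoint => 0
  | .onePoint => (c.h - f c.y) ^ 2

theorem Feedback.carriedError_nonneg (f : Vec d → ℝ) (c : Core d) : 0 ≤ o.carriedError f c := by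
  cases o
  · exact le_rfl
  · exact sq_nonneg _

theorem Feedback.measurable_carriedError {f : Vec d → ℝ} (hf : Measurable f) :
    Measurable (o.carriedError f) := by
  cases o
  · exact measurable_const
  · unfold Feedback.carriedError; fun_prop

/-- The value `f y` at the new point is inserted between the two answers. A fresh answer deviates
from it by noise and a displacement of `δ`. The carried answer of Option II deviates by its own
error and the change of `f` between consecutive points `y`. -/
theorem lintegral_stepLaw_estimate_le [NeZero d] (hN : P.NoiseBound σ) (hL : 0 ≤ L) (hδ : 0 < p.δ)
    (hf : ∀ x y, |P.objective x - P.objective y| ≤ L * ‖x - y‖) (hfc : Continuous P.objective)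
    {D : ℝ} (hD : 0 ≤ D) {c : Core d} (hc : c.Near D) :
    ∫⁻ w, ENNReal.ofReal (‖(o.factor d p.δ * (w.2.1 - w.2.2)) • w.1.2‖ ^ 2)
      ∂(stepLaw P o p n c) ≤
      ENNReal.ofReal (((d : ℝ) / p.δ) ^ 2 *
        (2 * answerBound σ L p.δ + 4 * o.carriedError P.objective c + 16 * (L * D) ^ 2)) := by
  have hfm := hfc.measurable
  have hV := answerBound_nonneg σ L p.δ
  rw [stepLaw, Measure.lintegral_compProd (by fun_prop)]
  refine (lintegral_mono_ae (g := fun _ => ENNReal.ofReal (((d : ℝ) / p.δ) ^ 2 *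
        (2 * answerBound σ L p.δ + 4 * o.carriedError P.objective c + 16 * (L * D) ^ 2))) ?_).trans_eq
    (by simp)
  filter_upwards [ae_unif (d := d)] with w hw
  set y := nextY p n (c, w) with hy
  have hα : 0 ≤ 2 * (o.factor d p.δ) ^ 2 := by positivity
  have hmono : ∀ h : ℝ × ℝ, ENNReal.ofReal (‖(o.factor d p.δ * (h.1 - h.2)) • w.2‖ ^ 2) ≤
      ENNReal.ofReal (2 * (o.factor d p.δ) ^ 2) * (ENNReal.ofReal ((h.1 - P.objective y) ^ 2) +
        ENNReal.ofReal ((h.2 - P.objective y) ^ 2)) := by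
    intro h
    rw [← ENNReal.ofReal_add (sq_nonneg _) (sq_nonneg _), ← ENNReal.ofReal_mul hα]
    refine ENNReal.ofReal_le_ofReal ?_
    rw [norm_smul, hw.2, mul_one, Real.norm_eq_abs, sq_abs, mul_pow]
    have : (h.1 - h.2) ^ 2 ≤ 2 * ((h.1 - P.objective y) ^ 2 + (h.2 - P.objective y) ^ 2) := by
      nlinarith [sq_nonneg ((h.1 - P.objective y) + (h.2 - P.objective y))]
    nlinarith [mul_le_mul_of_nonneg_left this (sq_nonneg (o.factor d p.δ))]
  refine (lintegral_mono hmono).trans ?_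
  rw [lintegral_const_mul _ (by fun_prop), lintegral_add_left (by fun_prop)]
  have h1 : ∫⁻ h, ENNReal.ofReal ((h.1 - P.objective y) ^ 2) ∂(answers P o p n c w) ≤
      ENNReal.ofReal (answerBound σ L p.δ) :=
    (lintegral_answers_fst o n P c w (φ := fun h => ENNReal.ofReal ((h - P.objective y) ^ 2))
      (by fun_prop)).trans_le (lintegral_queryPlus_le n hN hδ.le hf (c, w) hw.2)
  cases o
  · have h2 : ∫⁻ h, ENNReal.ofReal ((h.2 - P.objective y) ^ 2) ∂(answers P .twoPoint p n c w) ≤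
        ENNReal.ofReal (answerBound σ L p.δ) :=
      (lintegral_answers_snd_twoPoint n P c w
        (φ := fun h => ENNReal.ofReal ((h - P.objective y) ^ 2))
        (by fun_prop)).trans_le (lintegral_queryMinus_le n hN hδ.le hf (c, w) hw.2)
    refine (mul_le_mul_right (add_le_add h1 h2) _).trans ?_
    rw [← ENNReal.ofReal_add hV hV, ← ENNReal.ofReal_mul hα]
    refine ENNReal.ofReal_le_ofReal ?_
    have hfac : 2 * (Feedback.twoPoint.factor d p.δ) ^ 2 = ((d : ℝ) / p.δ) ^ 2 * (1 / 2) := by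
      simp only [Feedback.factor]
      rw [mul_comm 2 p.δ, ← div_div, div_pow]; ring
    rw [hfac, mul_assoc]
    refine mul_le_mul_of_nonneg_left ?_ (sq_nonneg _)
    simp only [Feedback.carriedError]
    nlinarith [sq_nonneg (L * D)]
  · have h2 : ∫⁻ h, ENNReal.ofReal ((h.2 - P.objective y) ^ 2) ∂(answers P .onePoint p n c w) ≤
        ENNReal.ofReal (2 * (c.h - P.objective c.y) ^ 2 + 8 * (L * D) ^ 2) := by
      rw [lintegral_answers_snd_onePoint n P c w
        (φ := fun h => ENNReal.ofReal ((h - P.objective y) ^ 2)) (by fun_prop)]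
      refine ENNReal.ofReal_le_ofReal ?_
      -- Both points are within `D` of `c.x`: the old one by `Near`, the new one because it lies on
      -- the step out of `c.x`.
      have hdist : ‖c.y - y‖ ≤ 2 * D := by
        have h3 := (norm_nextY_sub_x_le (p := p) n (c, w) hw.1).trans (hc.norm_currentΔ_le n hD)
        have h4 : c.y - y = -((y - c.x) + (c.x - c.y)) := by abel
        rw [h4, norm_neg]
        refine (norm_add_le _ _).trans ?_
        have := hc.1
        linarith
      have h5 : (P.objective c.y - P.objective y) ^ 2 ≤ (L * (2 * D)) ^ 2 :=
        sq_le_sq' (by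
          have := (abs_le.1 (hf c.y y)).1
          nlinarith [mul_le_mul_of_nonneg_left hdist hL]) (by
          have := (abs_le.1 (hf c.y y)).2
          nlinarith [mul_le_mul_of_nonneg_left hdist hL])
      nlinarith [sq_nonneg ((c.h - P.objective c.y) - (P.objective c.y - P.objective y))]
    refine (mul_le_mul_right (add_le_add h1 h2) _).trans ?_
    rw [← ENNReal.ofReal_add hV (by positivity), ← ENNReal.ofReal_mul hα]
    refine ENNReal.ofReal_le_ofReal ?_
    simp only [Feedback.factor, Feedback.carriedError]
    apply le_of_eq
    ring

end StepMoments
-- Conditional means within one iteration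
section StepMean

variable {d : ℕ} [NeZero d] {Z : Type*} [MeasurableSpace Z] {P : Problem d Z} {σ L : ℝ}
  {o : Feedback} {p : Params} {n : ℕ}

/-- Moment bounds are proved for `lintegral`, where no integrability is needed beforehand; this and
the next lemma turn them into integrability and Bochner bounds. -/
theorem memLp_two_of_lintegral_sq_le {Ω E : Type*} [MeasurableSpace Ω] {μ : Measure Ω}
    [NormedAddCommGroup E] {φ : Ω → E} (hφ : AEStronglyMeasurable φ μ)
    {C : ℝ} (h : ∫⁻ ω, ENNReal.ofReal (‖φ ω‖ ^ 2) ∂μ ≤ ENNReal.ofReal C) :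
    MemLp φ 2 μ := by
  rw [memLp_two_iff_integrable_sq_norm hφ]
  refine ⟨(hφ.norm.pow 2), ?_⟩
  rw [hasFiniteIntegral_iff_ofReal (Filter.Eventually.of_forall fun _ => by positivity)]
  exact h.trans_lt ENNReal.ofReal_lt_top

theorem integral_sq_le_of_lintegral_sq_le {Ω E : Type*} [MeasurableSpace Ω] {μ : Measure Ω}
    [NormedAddCommGroup E] {φ : Ω → E} (hφ : AEStronglyMeasurable φ μ)
    {C : ℝ} (hC : 0 ≤ C) (h : ∫⁻ ω, ENNReal.ofReal (‖φ ω‖ ^ 2) ∂μ ≤ ENNReal.ofReal C) :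
    ∫ ω, ‖φ ω‖ ^ 2 ∂μ ≤ C := by
  rw [integral_eq_lintegral_of_nonneg_ae (f := fun ω => ‖φ ω‖ ^ 2) (Filter.Eventually.of_forall fun _ => by positivity)
    (hφ.norm.pow 2)]
  exact ENNReal.toReal_le_of_le_ofReal hC h

/-- The conditional mean, given the draws, of the second of the two values in `answers`. -/
noncomputable def secondMean (P : Problem d Z) (o : Feedback) (p : Params) (n : ℕ) (c : Core d)
    (w : ℝ × Vec d) : ℝ :=
  match o with
  | .twoPoint => P.objective (queryMinus p n (c, w))
  | .onePoint => c.h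

omit [NeZero d] in
theorem integral_answers (hN : P.NoiseBound σ) (o : Feedback) (c : Core d) (w : ℝ × Vec d) :
    ∫ h, (o.factor d p.δ * (h.1 - h.2)) • w.2 ∂(answers P o p n c w) =
      (o.factor d p.δ * (P.objective (queryPlus p n (c, w)) - secondMean P o p n c w)) • w.2 := by
  have h1 := hN.integrable_szo (queryPlus p n (c, w))
  rw [integral_smul_const, integral_const_mul]
  congr 2
  cases o
  · have h2 := hN.integrable_szo (queryMinus p n (c, w))
    rw [answers, Kernel.prod_apply]
    change ∫ h : ℝ × ℝ, h.1 - h.2 ∂((P.szo _).prod (P.szo _)) = _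
    rw [integral_sub (h1.comp_fst _) (h2.comp_snd _),
      integral_fun_fst (fun x : ℝ => x), integral_fun_snd (fun x : ℝ => x)]
    simp [Problem.integral_szo, secondMean]
  · rw [answers, Kernel.prod_apply]
    change ∫ h : ℝ × ℝ, h.1 - h.2 ∂((P.szo _).prod (Measure.dirac c.h)) = _
    have h2 : Integrable (fun h : ℝ => h) (Measure.dirac c.h) := integrable_dirac (by simp)
    rw [integral_sub (h1.comp_fst _) (h2.comp_snd _),
      integral_fun_fst (fun x : ℝ => x), integral_fun_snd (fun x : ℝ => x)]
    simp [Problem.integral_szo, secondMean]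

/-- For Option I this is the symmetry `u ↦ -u`. For Option II the old answer does not depend on the
fresh direction, so its contribution vanishes with the mean of `u`. -/
theorem integral_unifSphere_answers (hfc : Continuous P.objective) (o : Feedback) (c : Core d)
    (s : ℝ) :
    ∫ u, (o.factor d p.δ * (P.objective (queryPlus p n (c, s, u)) -
      secondMean P o p n c (s, u))) • u ∂(unifSphere d) =
      meanEstimate P.objective p.δ (c.x + s • currentΔ p n c) := by
  cases o
  · simp only [queryPlus, nextY, Feedback.factor, secondMean, queryMinus]
    exact meanEstimate_eq_twoPoint hfc p.δ _
  · simp only [queryPlus, nextY, Feedback.factor, secondMean]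
    have h1 : Integrable (fun u : Vec d => ((d : ℝ) / p.δ *
        P.objective (c.x + s • currentΔ p n c + p.δ • u)) • u) (unifSphere d) :=
      integrable_unifSphere_of_continuous (by fun_prop)
    have h2 : Integrable (fun u : Vec d => ((d : ℝ) / p.δ * c.h) • u) (unifSphere d) :=
      integrable_unifSphere_of_continuous (by fun_prop)
    simp_rw [mul_sub, sub_smul]
    rw [integral_sub h1 h2, integral_smul, integral_id_unifSphere, smul_zero, sub_zero]
    rfl

theorem integral_stepLaw_estimate (hN : P.NoiseBound σ) (hfc : Continuous P.objective)
    (c : Core d) (hi : Integrable (fun w : (ℝ × Vec d) × (ℝ × ℝ) =>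
      (o.factor d p.δ * (w.2.1 - w.2.2)) • w.1.2) (stepLaw P o p n c)) :
    ∫ w, (o.factor d p.δ * (w.2.1 - w.2.2)) • w.1.2 ∂(stepLaw P o p n c) =
      ∫ s in (0 : ℝ)..1, meanEstimate P.objective p.δ (c.x + s • currentΔ p n c) := by
  rw [stepLaw] at hi ⊢
  have hi2 : Integrable (fun w : ℝ × Vec d => ∫ h, (o.factor d p.δ * (h.1 - h.2)) • w.2
      ∂(answers P o p n c w)) (unifInterval.prod (unifSphere d)) := by
    have := Integrable.integral_compProd (κ := Kernel.const Unit (unifInterval.prod (unifSphere d)))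
      (η := Kernel.prodMkLeft Unit (answers P o p n c)) (a := ()) hi
    simpa using this
  rw [Measure.integral_compProd hi]
  simp only [integral_answers hN] at hi2 ⊢
  rw [integral_prod _ hi2]
  simp only [integral_unifSphere_answers hfc]
  rw [intervalIntegral.integral_of_le zero_le_one, unifInterval, integral_Icc_eq_integral_Ioc]

/-! ### One iteration -/

/-- The relation between the data before and after iteration `n + 1`. -/
def Transition (o : Feedback) (p : Params) (n : ℕ) (c z : Iterate d) : Prop :=
  z.1.x = c.1.x + currentΔ p n c.1 ∧
  z.1.Δ = projBall p.D (currentΔ p n c.1 - p.η • z.1.g) ∧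
  ‖z.1.y - c.1.x‖ ≤ ‖currentΔ p n c.1‖ ∧
  ‖z.1.x - z.1.y‖ ≤ ‖currentΔ p n c.1‖ ∧
  z.2 = c.2 + o.cost

omit [NeZero d] in
theorem measurableSet_transition :
    MeasurableSet {w : Iterate d × Iterate d | Transition o p n w.1 w.2} := by
  unfold Transition
  exact (measurableSet_eq_fun (f := fun w : Iterate d × Iterate d => w.2.1.x) (g := fun w => w.1.1.x + currentΔ p n w.1.1) (by fun_prop) (by fun_prop)).inter
    ((measurableSet_eq_fun (f := fun w : Iterate d × Iterate d => w.2.1.Δ) (g := fun w => projBall p.D (currentΔ p n w.1.1 - p.η • w.2.1.g)) (by fun_prop) (by fun_prop)).inter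
    ((measurableSet_le (f := fun w : Iterate d × Iterate d => ‖w.2.1.y - w.1.1.x‖) (g := fun w => ‖currentΔ p n w.1.1‖) (by fun_prop) (by fun_prop)).inter
    ((measurableSet_le (f := fun w : Iterate d × Iterate d => ‖w.2.1.x - w.2.1.y‖) (g := fun w => ‖currentΔ p n w.1.1‖) (by fun_prop) (by fun_prop)).inter
    (measurableSet_eq_fun (f := fun w : Iterate d × Iterate d => w.2.2) (g := fun w => w.1.2 + o.cost) (by fun_prop) (by fun_prop)))))

theorem ae_step_transition (P : Problem d Z) (c : Iterate d) :
    ∀ᵐ z ∂(step P o p n c), Transition o p n c z := by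
  rw [step_apply, ae_map_iff (by fun_prop)
    (show MeasurableSet {z | Transition o p n c z} from
      (measurable_prodMk_left (x := c)) (measurableSet_transition (o := o) (p := p) (n := n)))]
  filter_upwards [ae_stepLaw o p n P c.1] with w hw
  exact ⟨rfl, rfl, norm_nextY_sub_x_le n (c.1, w.1) hw.1, norm_nextX_sub_nextY_le n (c.1, w.1) hw.1,
    rfl⟩

theorem lintegral_step_error_le (hN : P.NoiseBound σ) (hδ : 0 ≤ p.δ)
    (hf : ∀ x y, |P.objective x - P.objective y| ≤ L * ‖x - y‖) (hfc : Continuous P.objective)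
    (c : Iterate d) :
    ∫⁻ z, ENNReal.ofReal ((z.1.h - P.objective z.1.y) ^ 2) ∂(step P o p n c) ≤
      ENNReal.ofReal (answerBound σ L p.δ) := by
  have hfm := hfc.measurable
  rw [step_apply, lintegral_map (by fun_prop) (by fun_prop)]
  exact lintegral_stepLaw_last_le o n hN hδ hf hfc c.1

theorem lintegral_step_estimate_le (hN : P.NoiseBound σ) (hL : 0 ≤ L) (hδ : 0 < p.δ)
    (hf : ∀ x y, |P.objective x - P.objective y| ≤ L * ‖x - y‖) (hfc : Continuous P.objective)
    {D : ℝ} (hD : 0 ≤ D) {c : Iterate d} (hc : c.1.Near D) :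
    ∫⁻ z, ENNReal.ofReal (‖z.1.g‖ ^ 2) ∂(step P o p n c) ≤
      ENNReal.ofReal (((d : ℝ) / p.δ) ^ 2 *
        (2 * answerBound σ L p.δ + 4 * o.carriedError P.objective c.1 + 16 * (L * D) ^ 2)) := by
  rw [step_apply, lintegral_map (by fun_prop) (by fun_prop)]
  exact lintegral_stepLaw_estimate_le o n hN hL hδ hf hfc hD hc

theorem integral_step_of_y {F : Type*} [NormedAddCommGroup F] [NormedSpace ℝ F]
    (P : Problem d Z) (c : Iterate d) {φ : Vec d → F} (hφ : StronglyMeasurable φ) :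
    ∫ z, φ z.1.y ∂(step P o p n c) =
      ∫ s in (0 : ℝ)..1, φ (c.1.x + s • currentΔ p n c.1) := by
  rw [step_apply, integral_map (f := fun z : Iterate d => φ z.1.y) (by fun_prop)
    (hφ.comp_measurable (by fun_prop : Measurable fun z : Iterate d => z.1.y)).aestronglyMeasurable]
  exact integral_stepLaw_fst o p n P c.1
    (hφ.comp_measurable (by fun_prop : Measurable fun s : ℝ => c.1.x + s • currentΔ p n c.1))

/-- The point `y` is uniform on the segment from `x` to `x + Δ`, so the expectation is the integral
of the derivative of `f` along that segment. The random `s` makes the identity exact, with no Taylor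
error. -/
theorem integral_step_progress (P : Problem d Z) {L_H : ℝ}
    (hH : HasLipschitzHessian P.objective L_H) (c : Iterate d) :
    ∫ z, inner ℝ (gradient P.objective z.1.y) (currentΔ p n c.1) ∂(step P o p n c) =
      P.objective (c.1.x + currentΔ p n c.1) - P.objective c.1.x := by
  have hg := hH.continuous_gradient
  rw [integral_step_of_y P c
    (φ := fun y => inner ℝ (gradient P.objective y) (currentΔ p n c.1))
    (Continuous.stronglyMeasurable (by fun_prop))]
  set v := currentΔ p n c.1
  have hder : ∀ s : ℝ, HasDerivAt (fun s : ℝ => P.objective (c.1.x + s • v))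
      (inner ℝ (gradient P.objective (c.1.x + s • v)) v) s := by
    intro s
    have h1 : HasDerivAt (fun s : ℝ => c.1.x + s • v) v s := by
      simpa using ((hasDerivAt_id s).smul_const v).const_add c.1.x
    have h2 := (hH.1 (c.1.x + s • v)).hasFDerivAt.comp_hasDerivAt s h1
    rwa [← inner_gradient] at h2
  rw [intervalIntegral.integral_eq_sub_of_hasDerivAt (fun s _ => hder s)
    (Continuous.intervalIntegrable (by fun_prop) _ _)]
  simp

/-- Both terms have mean the integral over `s` of `meanEstimate` along the segment. The mean is
taken given the past only, not given `y`; this suffices because the noise is paired only with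
functions of the past. -/
theorem integral_step_noise (hN : P.NoiseBound σ) (hL : 0 ≤ L) (hδ : 0 < p.δ)
    (hf : ∀ x y, |P.objective x - P.objective y| ≤ L * ‖x - y‖) (hfc : Continuous P.objective)
    {D : ℝ} (hD : 0 ≤ D) {c : Iterate d} (hc : c.1.Near D) :
    Integrable (fun z => z.1.g - meanEstimate P.objective p.δ z.1.y) (step P o p n c) ∧
      ∫ z, (z.1.g - meanEstimate P.objective p.δ z.1.y) ∂(step P o p n c) = 0 := by
  have hm := stronglyMeasurable_meanEstimate hfc p.δ
  have hmy : StronglyMeasurable fun z : Iterate d => meanEstimate P.objective p.δ z.1.y :=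
    hm.comp_measurable (by fun_prop)
  have hg : AEStronglyMeasurable (fun z : Iterate d => z.1.g) (step P o p n c) := by fun_prop
  have hi1 : Integrable (fun z : Iterate d => z.1.g) (step P o p n c) :=
    (memLp_two_of_lintegral_sq_le hg
      (lintegral_step_estimate_le hN hL hδ hf hfc hD hc)).integrable (by norm_num)
  have hi2 : Integrable (fun z : Iterate d => meanEstimate P.objective p.δ z.1.y)
      (step P o p n c) :=
    Integrable.of_bound hmy.aestronglyMeasurable _
      (Filter.Eventually.of_forall fun z => norm_meanEstimate_le hδ hf hfc z.1.y)
  refine ⟨hi1.sub hi2, ?_⟩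
  rw [integral_sub hi1 hi2, integral_step_of_y P c hm, sub_eq_zero]
  rw [step_apply] at hi1 ⊢
  rw [integrable_map_measure (by fun_prop) (by fun_prop)] at hi1
  rw [integral_map (by fun_prop) (by fun_prop)]
  exact integral_stepLaw_estimate hN hfc c.1 hi1

end StepMean
-- The Markov property of the run and its almost sure properties
section Run

variable {d : ℕ} [NeZero d] {Z : Type*} [MeasurableSpace Z] (P : Problem d Z)
  (o : Feedback) (p : Params)

theorem run_map_zero : (run P o p).map (fun ω => ω 0) = start P o p := by
  have h : (fun ω : ℕ → Iterate d => ω 0) =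
      (MeasurableEquiv.piUnique (fun _ : Finset.Iic 0 => Iterate d)) ∘
        (Preorder.frestrictLe (π := fun _ => Iterate d) 0) := rfl
  rw [h, ← Measure.map_map (by fun_prop) (by fun_prop), run, Kernel.trajMeasure,
    Measure.map_comp _ _ (by fun_prop), Kernel.traj_map_frestrictLe, Kernel.partialTraj_self,
    Measure.id_comp, Measure.map_map (by fun_prop) (by fun_prop)]
  rw [MeasurableEquiv.self_comp_symm, Measure.map_id]

theorem run_map_succ (n : ℕ) :
    (run P o p).map (fun ω => (Preorder.frestrictLe (π := fun _ => Iterate d) n ω, ω (n + 1))) =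
      ((run P o p).map (Preorder.frestrictLe n)) ⊗ₘ ((step P o p n).comap
      (fun past : (Π _ : Finset.Iic n, Iterate d) => past ⟨n, by simp⟩) (by fun_prop)) :=
  (Kernel.map_frestrictLe_trajMeasure_compProd_eq_map_trajMeasure (X := fun _ => Iterate d)).symm

variable {P o p}

theorem lintegral_run_succ (n : ℕ) {Φ : Iterate d × Iterate d → ENNReal} (hΦ : Measurable Φ) :
    ∫⁻ ω, Φ (ω n, ω (n + 1)) ∂(run P o p) =
      ∫⁻ ω, ∫⁻ z, Φ (ω n, z) ∂(step P o p n (ω n)) ∂(run P o p) := by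
  have h := lintegral_map (μ := run P o p)
    (f := fun x : (Π _ : Finset.Iic n, Iterate d) × Iterate d => Φ (x.1 ⟨n, by simp⟩, x.2))
    (g := fun ω => (Preorder.frestrictLe (π := fun _ => Iterate d) n ω, ω (n + 1)))
    (by fun_prop) (by fun_prop)
  rw [run_map_succ, Measure.lintegral_compProd (by fun_prop), lintegral_map] at h
  · exact h.symm
  · exact Measurable.lintegral_kernel_prod_right' (κ := (step P o p n).comap
      (fun past : (Π _ : Finset.Iic n, Iterate d) => past ⟨n, by simp⟩) (by fun_prop))
      (f := fun x : (Π _ : Finset.Iic n, Iterate d) × Iterate d => Φ (x.1 ⟨n, by simp⟩, x.2))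
      (by fun_prop)
  · fun_prop

/-- The path that agrees with a finite past and vanishes afterwards. -/
noncomputable def extendPast (n : ℕ) (x : Π _ : Finset.Iic n, Iterate d) : ℕ → Iterate d :=
  fun i => if h : i ≤ n then x ⟨i, by simpa using h⟩ else 0

omit [NeZero d] in
@[fun_prop]
theorem measurable_extendPast (n : ℕ) :
    Measurable (extendPast n : (Π _ : Finset.Iic n, Iterate d) → _) := by
  refine measurable_pi_lambda _ fun i => ?_
  unfold extendPast
  split_ifs <;> fun_prop

/-- This plays the role of conditioning on the first `n` iterations. A function of the path that
ignores later coordinates factors through the finite past by `extendPast`, and `run_map_succ`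
disintegrates the joint law of past and next iterate. -/
theorem integral_run_succ (n : ℕ) {Φ : (ℕ → Iterate d) × Iterate d → ℝ} (hΦ : Measurable Φ)
    (hdep : ∀ ω ω' z, (∀ i ≤ n, ω i = ω' i) → Φ (ω, z) = Φ (ω', z))
    (hi : Integrable (fun ω => Φ (ω, ω (n + 1))) (run P o p)) :
    ∫ ω, Φ (ω, ω (n + 1)) ∂(run P o p) =
      ∫ ω, ∫ z, Φ (ω, z) ∂(step P o p n (ω n)) ∂(run P o p) := by
  set r : (ℕ → Iterate d) → (Π _ : Finset.Iic n, Iterate d) :=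
    Preorder.frestrictLe (π := fun _ => Iterate d) n with hr
  have hrm : Measurable r := Preorder.measurable_frestrictLe n
  have hext : ∀ ω z, Φ (extendPast n (r ω), z) = Φ (ω, z) := fun ω z =>
    hdep _ _ _ fun i hi => by simp [extendPast, hi, hr]
  set Ψ : (Π _ : Finset.Iic n, Iterate d) × Iterate d → ℝ := fun x => Φ (extendPast n x.1, x.2)
  have hΨ : Measurable Ψ := by fun_prop
  have hi' : Integrable Ψ ((run P o p).map (fun ω => (r ω, ω (n + 1)))) := by
    rw [integrable_map_measure hΨ.aestronglyMeasurable (by fun_prop)]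
    exact hi.congr (Filter.Eventually.of_forall fun ω => (hext ω _).symm)
  have h := integral_map (μ := run P o p) (f := Ψ) (φ := fun ω => (r ω, ω (n + 1)))
    (by fun_prop) hΨ.aestronglyMeasurable
  have h2 : ∫ ω, Ψ (r ω, ω (n + 1)) ∂(run P o p) = ∫ ω, Φ (ω, ω (n + 1)) ∂(run P o p) :=
    integral_congr_ae (Filter.Eventually.of_forall fun ω => hext ω _)
  rw [h2] at h
  rw [← h]
  rw [run_map_succ] at hi' ⊢
  rw [Measure.integral_compProd hi', integral_map hrm.aemeasurable]
  · refine integral_congr_ae (Filter.Eventually.of_forall fun ω => ?_)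
    exact integral_congr_ae (Filter.Eventually.of_forall fun z => hext ω z)
  · exact (hΨ.stronglyMeasurable.integral_kernel_prod_right' (κ := (step P o p n).comap
      (fun past : (Π _ : Finset.Iic n, Iterate d) => past ⟨n, by simp⟩)
      (by fun_prop))).aestronglyMeasurable

theorem ae_run_transition (n : ℕ) :
    ∀ᵐ ω ∂(run P o p), Transition o p n (ω n) (ω (n + 1)) := by
  set I : Iterate d × Iterate d → ENNReal :=
    Set.indicator {w | Transition o p n w.1 w.2}ᶜ 1 with hI
  have hIm : Measurable I := measurable_one.indicator measurableSet_transition.compl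
  have h := lintegral_run_succ (P := P) (o := o) (p := p) n hIm
  have h0 : ∀ c : Iterate d, ∫⁻ z, I (c, z) ∂(step P o p n c) = 0 := by
    intro c
    rw [← lintegral_zero (μ := step P o p n c)]
    refine lintegral_congr_ae ?_
    filter_upwards [ae_step_transition (o := o) (p := p) (n := n) P c] with z hz
    simp [hI, hz]
  simp only [h0, lintegral_zero] at h
  rw [lintegral_eq_zero_iff (f := fun ω : ℕ → Iterate d => I (ω n, ω (n + 1)))
    (by fun_prop)] at h
  filter_upwards [h] with ω hω
  by_contra hcon
  simp [hI, hcon] at hω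

/-- The number of oracle calls before the first iteration. -/
def Feedback.startCost : Feedback → ℕ
  | .twoPoint => 0
  | .onePoint => 1

variable (P o p) in
omit [NeZero d] in
theorem ae_start : ∀ᵐ c ∂(start P o p), (c.1.x = 0 ∧ c.1.y = 0 ∧ c.1.Δ = 0) ∧
    c.2 = o.startCost := by
  have hm : MeasurableSet {c : Iterate d | (c.1.x = 0 ∧ c.1.y = 0 ∧ c.1.Δ = 0) ∧
      c.2 = o.startCost} :=
    ((measurableSet_eq_fun (f := fun c : Iterate d => c.1.x) (g := fun _ => 0)
      (by fun_prop) (by fun_prop)).inter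
    ((measurableSet_eq_fun (f := fun c : Iterate d => c.1.y) (g := fun _ => 0)
      (by fun_prop) (by fun_prop)).inter
    (measurableSet_eq_fun (f := fun c : Iterate d => c.1.Δ) (g := fun _ => 0)
      (by fun_prop) (by fun_prop)))).inter
    (measurableSet_eq_fun (f := fun c : Iterate d => c.2) (g := fun _ => o.startCost)
      (by fun_prop) (by fun_prop))
  cases o
  · rw [start, ae_dirac_iff hm]
    exact ⟨⟨rfl, rfl, rfl⟩, rfl⟩
  · have hc : ∀ᵐ w ∂((P.call (fun u : Vec d => (0 : Vec d) + p.δ • u) (by fun_prop)) ∘ₘ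
        ((unifSphere d).map (fun u => (u, 0)))), w.2 = 1 := by
      rw [Measure.ae_comp_iff (measurableSet_eq_fun (by fun_prop) (by fun_prop)),
        ae_map_iff (by fun_prop)]
      · refine Filter.Eventually.of_forall fun u => ?_
        rw [P.call_apply, ae_map_iff (by fun_prop)
          (measurableSet_eq_fun (by fun_prop) (by fun_prop))]
        exact Filter.Eventually.of_forall fun _ => rfl
      · exact (Kernel.measurable_coe (P.call (fun u : Vec d => (0 : Vec d) + p.δ • u) (by fun_prop))
          (s := {w | ¬ w.2 = 1})
          (measurableSet_eq_fun (by fun_prop) (by fun_prop)).compl) (measurableSet_singleton 0)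
    rw [start, ae_map_iff (by fun_prop) hm]
    filter_upwards [hc] with w hw
    exact ⟨⟨rfl, rfl, rfl⟩, hw⟩

theorem lintegral_start_carriedError_le {σ L : ℝ} (hN : P.NoiseBound σ) (hδ : 0 ≤ p.δ)
    (hf : ∀ x y, |P.objective x - P.objective y| ≤ L * ‖x - y‖) (hfc : Continuous P.objective) :
    ∫⁻ c, ENNReal.ofReal (o.carriedError P.objective c.1) ∂(start P o p) ≤
      ENNReal.ofReal (answerBound σ L p.δ) := by
  have hfm := hfc.measurable
  cases o
  · simp [Feedback.carriedError]
  · simp only [Feedback.carriedError]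
    rw [start, lintegral_map (by fun_prop) (by fun_prop),
      Measure.lintegral_bind (Kernel.aemeasurable _) (by fun_prop), lintegral_map]
    · simp only [P.call_apply]
      refine (lintegral_mono_ae (g := fun _ => ENNReal.ofReal (answerBound σ L p.δ)) ?_).trans_eq
        (by simp)
      filter_upwards [ae_norm_unifSphere (d := d)] with u hu
      rw [lintegral_map (by fun_prop) (by fun_prop)]
      refine hN.lintegral_szo_sub_sq_le _ ((hf _ _).trans_eq ?_)
      simp [norm_smul, hu, abs_of_nonneg hδ]
    · exact Measurable.lintegral_kernel (by fun_prop)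
    · fun_prop

theorem ae_run_start : ∀ᵐ ω ∂(run P o p), ((ω 0).1.x = 0 ∧ (ω 0).1.y = 0 ∧ (ω 0).1.Δ = 0) ∧
    (ω 0).2 = o.startCost := by
  have h := ae_start P o p
  rw [← run_map_zero] at h
  exact ae_of_ae_map (measurable_pi_apply 0).aemeasurable h

/-- The properties that hold along almost every path. -/
def Regular (o : Feedback) (p : Params) (ω : ℕ → Iterate d) : Prop :=
  (((ω 0).1.x = 0 ∧ (ω 0).1.y = 0 ∧ (ω 0).1.Δ = 0) ∧ (ω 0).2 = o.startCost) ∧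
    ∀ n, Transition o p n (ω n) (ω (n + 1))

theorem ae_regular : ∀ᵐ ω ∂(run P o p), Regular o p ω :=
  ae_run_start.and (ae_all_iff.2 ae_run_transition)

omit [NeZero d] in
theorem Regular.near (hD : 0 ≤ p.D) {ω : ℕ → Iterate d} (h : Regular o p ω) (n : ℕ) :
    (ω n).1.Near p.D := by
  induction n with
  | zero =>
    obtain ⟨⟨⟨h1, h2, h3⟩, -⟩, -⟩ := h
    exact ⟨by rw [h1, h2]; simpa using hD, by rw [h3]; simpa using hD⟩
  | succ n ih =>
    obtain ⟨h1, h2, h3, h4, -⟩ := h.2 n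
    exact ⟨h4.trans (ih.norm_currentΔ_le n hD), by rw [h2]; exact norm_projBall_le hD _⟩

-- This crude bound grows with `n` and serves only for the integrability of `f` along the run.
omit [NeZero d] in
theorem Regular.norm_x_le (hD : 0 ≤ p.D) {ω : ℕ → Iterate d} (h : Regular o p ω) (n : ℕ) :
    ‖(ω n).1.x‖ ≤ n * p.D := by
  induction n with
  | zero => rw [h.1.1.1]; simp
  | succ n ih =>
    rw [(h.2 n).1]
    have h1 := (h.near hD n).norm_currentΔ_le (p := p) n hD
    refine (norm_add_le _ _).trans ?_
    push_cast
    linarith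

omit [NeZero d] in
theorem Regular.queries_eq {ω : ℕ → Iterate d} (h : Regular o p ω) (n : ℕ) :
    (ω n).2 = o.startCost + n * o.cost := by
  induction n with
  | zero => rw [h.1.2]; simp
  | succ n ih => rw [(h.2 n).2.2.2.2, ih]; ring

end Run
-- Moments along the run and orthogonality of the noise
section Moments

variable {d : ℕ} [NeZero d] {Z : Type*} [MeasurableSpace Z] {P : Problem d Z}
  {o : Feedback} {p : Params} {σ L L_H : ℝ}

/-- The regularity assumptions on the problem and the sign conditions on the parameters. -/
structure Admissible {d : ℕ} {Z : Type*} [MeasurableSpace Z] (P : Problem d Z) (p : Params)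
    (σ L L_H : ℝ) : Prop where
  noise : P.NoiseBound σ
  lipschitz : ∀ x y, |P.objective x - P.objective y| ≤ L * ‖x - y‖
  hessian : HasLipschitzHessian P.objective L_H
  L_nonneg : 0 ≤ L
  L_H_nonneg : 0 ≤ L_H
  δ_pos : 0 < p.δ
  D_pos : 0 < p.D

omit [NeZero d] in
theorem Admissible.continuous (h : Admissible P p σ L L_H) : Continuous P.objective :=
  h.hessian.1.continuous

theorem integrable_inner_of_memLp {Ω E : Type*} [MeasurableSpace Ω] {μ : Measure Ω}
    [NormedAddCommGroup E] [InnerProductSpace ℝ E] {f g : Ω → E} (hf : MemLp f 2 μ)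
    (hg : MemLp g 2 μ) : Integrable (fun ω => inner ℝ (f ω) (g ω)) μ :=
  (hf.norm.integrable_mul hg.norm).mono (hf.1.inner hg.1)
    (Filter.Eventually.of_forall fun ω => by
      simpa using abs_real_inner_le_norm (f ω) (g ω))

theorem integrable_sq_of_memLp {Ω E : Type*} [MeasurableSpace Ω] {μ : Measure Ω}
    [NormedAddCommGroup E] {f : Ω → E} (hf : MemLp f 2 μ) : Integrable (fun ω => ‖f ω‖ ^ 2) μ :=
  (memLp_two_iff_integrable_sq_norm hf.1).1 hf

/-- Bound on the second moment of the gradient estimate. -/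
noncomputable def estimateBound (d : ℕ) (p : Params) (σ L : ℝ) : ℝ :=
  ((d : ℝ) / p.δ) ^ 2 * (6 * answerBound σ L p.δ + 16 * (L * p.D) ^ 2)

omit [NeZero d] in
theorem estimateBound_nonneg : 0 ≤ estimateBound d p σ L := by
  have := answerBound_nonneg σ L p.δ
  unfold estimateBound; positivity

/-- Bound on the second moment of the gradient estimate minus its mean. -/
noncomputable def noiseMomentBound (d : ℕ) (p : Params) (σ L : ℝ) : ℝ :=
  2 * estimateBound d p σ L + 2 * (d * L) ^ 2

/-- The last answer was fresh when obtained, so its error bound holds conditionally on every earlier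
past, with no recursion in `n`. -/
theorem lintegral_run_carriedError_le (h : Admissible P p σ L L_H) (n : ℕ) :
    ∫⁻ ω, ENNReal.ofReal (o.carriedError P.objective (ω n).1) ∂(run P o p) ≤
      ENNReal.ofReal (answerBound σ L p.δ) := by
  have hm : Measurable (fun c : Iterate d => ENNReal.ofReal (o.carriedError P.objective c.1)) :=
    ((o.measurable_carriedError h.continuous.measurable).comp measurable_fst).ennreal_ofReal
  cases n with
  | zero =>
    have h1 := lintegral_map (μ := run P o p) (g := fun ω => ω 0) hm (measurable_pi_apply 0)
    rw [run_map_zero] at h1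
    rw [← h1]
    exact lintegral_start_carriedError_le h.noise h.δ_pos.le h.lipschitz h.continuous
  | succ n =>
    rw [lintegral_run_succ n (Φ := fun w => ENNReal.ofReal (o.carriedError P.objective w.2.1))
      (hm.comp measurable_snd)]
    refine (lintegral_mono (g := fun _ => ENNReal.ofReal (answerBound σ L p.δ))
      fun ω => ?_).trans_eq (by simp)
    cases o
    · simp [Feedback.carriedError]
    · exact lintegral_step_error_le h.noise h.δ_pos.le h.lipschitz h.continuous (ω n)

theorem lintegral_run_estimate_le (h : Admissible P p σ L L_H) (n : ℕ) :
    ∫⁻ ω, ENNReal.ofReal (‖(ω (n + 1)).1.g‖ ^ 2) ∂(run P o p) ≤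
      ENNReal.ofReal (estimateBound d p σ L) := by
  have hm : Measurable
      (fun ω : ℕ → Iterate d => ENNReal.ofReal (o.carriedError P.objective (ω n).1)) :=
    (((o.measurable_carriedError h.continuous.measurable).comp measurable_fst).comp
      (measurable_pi_apply n)).ennreal_ofReal
  have hV := answerBound_nonneg σ L p.δ
  rw [lintegral_run_succ n (Φ := fun w => ENNReal.ofReal (‖w.2.1.g‖ ^ 2)) (by fun_prop)]
  -- The one-step bound is affine in the carried error, whose mean is at most `answerBound`; thus
  -- the coefficients `2` and `4` add up to the `6` in `estimateBound`.
  calc _ ≤ ∫⁻ ω, (ENNReal.ofReal (((d : ℝ) / p.δ) ^ 2 *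
        (2 * answerBound σ L p.δ + 16 * (L * p.D) ^ 2)) + ENNReal.ofReal (((d : ℝ) / p.δ) ^ 2 * 4) *
        ENNReal.ofReal (o.carriedError P.objective (ω n).1)) ∂(run P o p) := by
        refine lintegral_mono_ae ?_
        filter_upwards [ae_regular (P := P) (o := o) (p := p)] with ω hω
        refine (lintegral_step_estimate_le h.noise h.L_nonneg h.δ_pos h.lipschitz h.continuous
          h.D_pos.le (hω.near h.D_pos.le n)).trans_eq ?_
        rw [← ENNReal.ofReal_mul (by positivity), ← ENNReal.ofReal_add (by positivity)
          (mul_nonneg (by positivity) (o.carriedError_nonneg _ _))]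
        congr 1; ring
    _ ≤ ENNReal.ofReal (((d : ℝ) / p.δ) ^ 2 *
        (2 * answerBound σ L p.δ + 16 * (L * p.D) ^ 2)) + ENNReal.ofReal (((d : ℝ) / p.δ) ^ 2 * 4) *
        ENNReal.ofReal (answerBound σ L p.δ) := by
        rw [lintegral_add_left measurable_const, lintegral_const_mul _ hm]
        simp only [lintegral_const, measure_univ, mul_one]
        gcongr
        exact lintegral_run_carriedError_le h n
    _ = _ := by
        rw [← ENNReal.ofReal_mul (by positivity), ← ENNReal.ofReal_add (by positivity)
          (by positivity), estimateBound]
        congr 1; ring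

theorem memLp_estimate (h : Admissible P p σ L L_H) (n : ℕ) :
    MemLp (fun ω => (ω (n + 1)).1.g) 2 (run P o p) :=
  memLp_two_of_lintegral_sq_le
    (by fun_prop : Measurable fun ω : ℕ → Iterate d => (ω (n + 1)).1.g).aestronglyMeasurable
    (lintegral_run_estimate_le h n)

theorem integral_estimate_sq_le (h : Admissible P p σ L L_H) (n : ℕ) :
    ∫ ω, ‖(ω (n + 1)).1.g‖ ^ 2 ∂(run P o p) ≤ estimateBound d p σ L :=
  integral_sq_le_of_lintegral_sq_le
    (by fun_prop : Measurable fun ω : ℕ → Iterate d => (ω (n + 1)).1.g).aestronglyMeasurable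
    estimateBound_nonneg
    (lintegral_run_estimate_le h n)

/-- The gradient estimate minus its mean. -/
noncomputable def estimateNoise (P : Problem d Z) (p : Params) (z : Iterate d) : Vec d :=
  z.1.g - meanEstimate P.objective p.δ z.1.y

theorem Admissible.measurable_meanEstimate (h : Admissible P p σ L L_H) :
    Measurable (meanEstimate P.objective p.δ) :=
  (stronglyMeasurable_meanEstimate h.continuous p.δ).measurable

theorem Admissible.measurable_noise (h : Admissible P p σ L L_H) : Measurable (estimateNoise P p) := by
  have := h.measurable_meanEstimate
  unfold estimateNoise; fun_prop

theorem memLp_noise (h : Admissible P p σ L L_H) (n : ℕ) :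
    MemLp (fun ω => estimateNoise P p (ω (n + 1))) 2 (run P o p) := by
  have hm := h.measurable_meanEstimate
  refine (memLp_estimate h n).sub (MemLp.of_bound
    (by fun_prop : Measurable fun ω : ℕ → Iterate d =>
      meanEstimate P.objective p.δ (ω (n + 1)).1.y).aestronglyMeasurable (d * L) ?_)
  exact Filter.Eventually.of_forall fun ω =>
    norm_meanEstimate_le h.δ_pos h.lipschitz h.continuous _

theorem norm_estimateNoise_sq_le (h : Admissible P p σ L L_H) (z : Iterate d) :
    ‖estimateNoise P p z‖ ^ 2 ≤ 2 * ‖z.1.g‖ ^ 2 + 2 * (d * L) ^ 2 := by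
  have h1 := norm_meanEstimate_le h.δ_pos h.lipschitz h.continuous z.1.y
  have h2 : ‖estimateNoise P p z‖ ≤ ‖z.1.g‖ + d * L :=
    (norm_sub_le _ _).trans (add_le_add_right h1 _)
  have h3 : ‖estimateNoise P p z‖ ^ 2 ≤ (‖z.1.g‖ + d * L) ^ 2 :=
    pow_le_pow_left₀ (norm_nonneg _) h2 2
  nlinarith [sq_nonneg (‖z.1.g‖ - d * L)]

theorem integral_noise_sq_le (h : Admissible P p σ L L_H) (n : ℕ) :
    ∫ ω, ‖estimateNoise P p (ω (n + 1))‖ ^ 2 ∂(run P o p) ≤ noiseMomentBound d p σ L := by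
  have hi := integrable_sq_of_memLp (memLp_estimate (o := o) h n)
  have hi2 : Integrable (fun ω : ℕ → Iterate d => 2 * ‖(ω (n + 1)).1.g‖ ^ 2 + 2 * (d * L) ^ 2)
      (run P o p) := (hi.const_mul 2).add (integrable_const _)
  refine (integral_mono (integrable_sq_of_memLp (memLp_noise h n)) hi2
    fun ω => norm_estimateNoise_sq_le h (ω (n + 1))).trans ?_
  have := integral_estimate_sq_le (o := o) h n
  rw [integral_add (hi.const_mul 2) (integrable_const _), integral_const_mul]
  simp only [integral_const, probReal_univ, one_smul, noiseMomentBound]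
  linarith

/-- The martingale difference property: given the past `V` is constant, and the noise has
conditional mean zero. -/
theorem integral_inner_noise (h : Admissible P p σ L L_H) (n : ℕ) {V : (ℕ → Iterate d) → Vec d}
    (hV : Measurable V) (hdep : ∀ ω ω', (∀ i ≤ n, ω i = ω' i) → V ω = V ω')
    (hV2 : MemLp V 2 (run P o p)) :
    ∫ ω, inner ℝ (V ω) (estimateNoise P p (ω (n + 1))) ∂(run P o p) = 0 := by
  have hnm := h.measurable_noise
  rw [integral_run_succ n (Φ := fun w => inner ℝ (V w.1) (estimateNoise P p w.2)) (by fun_prop)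
    (fun ω ω' z hω => by simp only [hdep ω ω' hω])
    (integrable_inner_of_memLp hV2 (memLp_noise h n))]
  refine integral_eq_zero_of_ae ?_
  filter_upwards [ae_regular (P := P) (o := o) (p := p)] with ω hω
  obtain ⟨h1, h2⟩ := integral_step_noise (n := n) (o := o) h.noise h.L_nonneg h.δ_pos h.lipschitz
    h.continuous h.D_pos.le (hω.near h.D_pos.le n)
  change ∫ z : Iterate d, inner ℝ (V ω) (z.1.g - meanEstimate P.objective p.δ z.1.y) ∂_ = 0
  rw [integral_inner h1, h2, inner_zero_right]

/-- The accumulated noise over `m` iterations after iteration `a`. -/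
noncomputable def noiseSum (P : Problem d Z) (p : Params) (a m : ℕ) (ω : ℕ → Iterate d) : Vec d :=
  ∑ j ∈ Finset.range m, estimateNoise P p (ω (a + j + 1))

theorem memLp_noiseSum (h : Admissible P p σ L L_H) (a m : ℕ) :
    MemLp (noiseSum P p a m) 2 (run P o p) :=
  memLp_finsetSum _ fun j _ => memLp_noise h (a + j)

/-- Each new noise term is orthogonal to the sum of the earlier ones, so the second moments add and
the bound is linear in `m`. -/
theorem integral_noiseSum_sq_le (h : Admissible P p σ L L_H) (a m : ℕ) :
    ∫ ω, ‖noiseSum P p a m ω‖ ^ 2 ∂(run P o p) ≤ m * noiseMomentBound d p σ L := by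
  have hnm := h.measurable_noise
  induction m with
  | zero => simp [noiseSum]
  | succ m ih =>
    have hS := memLp_noiseSum (o := o) h a m
    have hn := memLp_noise (o := o) h (a + m)
    have hexp : ∀ ω : ℕ → Iterate d, ‖noiseSum P p a (m + 1) ω‖ ^ 2 =
        ‖noiseSum P p a m ω‖ ^ 2 + 2 * inner ℝ (noiseSum P p a m ω) (estimateNoise P p (ω (a + m + 1))) +
          ‖estimateNoise P p (ω (a + m + 1))‖ ^ 2 := by
      intro ω
      rw [noiseSum, Finset.sum_range_succ, norm_add_sq_real]; rfl
    have hi1 := integrable_sq_of_memLp hS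
    have hi2 := (integrable_inner_of_memLp hS hn).const_mul 2
    have hi3 := integrable_sq_of_memLp hn
    have hz := integral_inner_noise (o := o) h (a + m) (V := noiseSum P p a m)
      (by unfold noiseSum; fun_prop)
      (fun ω ω' hω => Finset.sum_congr rfl fun j hj => by
        rw [hω _ (by have := Finset.mem_range.1 hj; omega)]) hS
    have hi12 : Integrable (fun ω => ‖noiseSum P p a m ω‖ ^ 2 +
        2 * inner ℝ (noiseSum P p a m ω) (estimateNoise P p (ω (a + m + 1)))) (run P o p) :=
      hi1.add hi2
    simp_rw [hexp]
    rw [integral_add hi12 hi3, integral_add hi1 hi2, integral_const_mul, hz]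
    have := integral_noise_sq_le (o := o) h (a + m)
    push_cast
    linarith

/-- The pointwise inequality s ≤ r/2 + s²/(2r) takes the place of Cauchy–Schwarz. -/
theorem integral_norm_noiseSum_le (h : Admissible P p σ L L_H) (a m : ℕ) {r : ℝ} (hr : 0 < r)
    (hr2 : m * noiseMomentBound d p σ L ≤ r ^ 2) :
    ∫ ω, ‖noiseSum P p a m ω‖ ∂(run P o p) ≤ r := by
  have hS := memLp_noiseSum (o := o) h a m
  have hi := integrable_sq_of_memLp hS
  calc ∫ ω, ‖noiseSum P p a m ω‖ ∂(run P o p)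
      ≤ ∫ ω, (r / 2 + (2 * r)⁻¹ * ‖noiseSum P p a m ω‖ ^ 2) ∂(run P o p) := by
        refine integral_mono (hS.integrable (by norm_num)).norm
          ((integrable_const _).add (hi.const_mul _)) fun ω => ?_
        have : r / 2 + (2 * r)⁻¹ * ‖noiseSum P p a m ω‖ ^ 2 - ‖noiseSum P p a m ω‖ =
            (r - ‖noiseSum P p a m ω‖) ^ 2 / (2 * r) := by field_simp; ring
        have h2 : 0 ≤ (r - ‖noiseSum P p a m ω‖) ^ 2 / (2 * r) := by positivity
        simp only
        linarith
    _ = r / 2 + (2 * r)⁻¹ * ∫ ω, ‖noiseSum P p a m ω‖ ^ 2 ∂(run P o p) := by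
        rw [integral_add (integrable_const _) (hi.const_mul _), integral_const_mul]
        simp
    _ ≤ r / 2 + (2 * r)⁻¹ * r ^ 2 := by
        gcongr
        exact (integral_noiseSum_sq_le h a m).trans hr2
    _ = r := by field_simp; ring

/-! ### Progress of one iteration -/

omit [NeZero d] in
theorem Admissible.measurable_gradient (h : Admissible P p σ L L_H) :
    Measurable (gradient P.objective) := h.hessian.continuous_gradient.measurable

theorem integrable_objective_x (h : Admissible P p σ L L_H) (n : ℕ) :
    Integrable (fun ω => P.objective (ω n).1.x) (run P o p) := by
  have hm := h.continuous.measurable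
  refine Integrable.of_bound (by fun_prop : Measurable fun ω : ℕ → Iterate d =>
    P.objective (ω n).1.x).aestronglyMeasurable (|P.objective 0| + L * (n * p.D)) ?_
  filter_upwards [ae_regular (P := P) (o := o) (p := p)] with ω hω
  have h1 := hω.norm_x_le h.D_pos.le n
  have h2 := h.lipschitz (ω n).1.x 0
  rw [sub_zero] at h2
  have h3 : P.objective (ω n).1.x = P.objective 0 + (P.objective (ω n).1.x - P.objective 0) := by
    ring
  rw [h3]
  refine (norm_add_le _ _).trans ?_
  have := mul_le_mul_of_nonneg_left h1 h.L_nonneg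
  simp only [Real.norm_eq_abs]
  linarith

theorem memLp_currentΔ (h : Admissible P p σ L L_H) (n : ℕ) :
    MemLp (fun ω => currentΔ p n (ω n).1) 2 (run P o p) := by
  refine MemLp.of_bound (by fun_prop : Measurable fun ω : ℕ → Iterate d =>
    currentΔ p n (ω n).1).aestronglyMeasurable p.D ?_
  filter_upwards [ae_regular (P := P) (o := o) (p := p)] with ω hω
  exact (hω.near h.D_pos.le n).norm_currentΔ_le n h.D_pos.le

theorem memLp_gradient_y (h : Admissible P p σ L L_H) (n : ℕ) :
    MemLp (fun ω => gradient P.objective (ω n).1.y) 2 (run P o p) := by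
  have hm := h.measurable_gradient
  exact MemLp.of_bound (by fun_prop : Measurable fun ω : ℕ → Iterate d =>
    gradient P.objective (ω n).1.y).aestronglyMeasurable L
    (Filter.Eventually.of_forall fun ω => norm_gradient_le h.L_nonneg h.lipschitz _)

theorem integral_gradient_inner (h : Admissible P p σ L L_H) (n : ℕ) :
    ∫ ω, inner ℝ (gradient P.objective (ω (n + 1)).1.y) (currentΔ p n (ω n).1) ∂(run P o p) =
      ∫ ω, P.objective (ω (n + 1)).1.x ∂(run P o p) - ∫ ω, P.objective (ω n).1.x ∂(run P o p) := by
  have hm := h.measurable_gradient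
  rw [integral_run_succ n (Φ := fun w =>
      inner ℝ (gradient P.objective w.2.1.y) (currentΔ p n (w.1 n).1)) (by fun_prop)
    (fun ω ω' z hω => by simp only [hω n le_rfl])
    (integrable_inner_of_memLp (memLp_gradient_y h (n + 1)) (memLp_currentΔ h n)),
    ← integral_sub (integrable_objective_x h (n + 1)) (integrable_objective_x h n)]
  refine integral_congr_ae ?_
  filter_upwards [ae_regular (P := P) (o := o) (p := p)] with ω hω
  rw [integral_step_progress P h.hessian, (hω.2 n).1]

/-- Replacing the gradient by the estimate changes the pairing by noise and bias. The noise is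
orthogonal to the increment, which is fixed by the past; the bias costs at most `L_H / 2 * p.δ ^ 2`
times `p.D`. -/
theorem integral_estimate_inner_ge (h : Admissible P p σ L L_H) (n : ℕ) :
    ∫ ω, P.objective (ω (n + 1)).1.x ∂(run P o p) - ∫ ω, P.objective (ω n).1.x ∂(run P o p) -
        L_H / 2 * p.δ ^ 2 * p.D ≤
      ∫ ω, inner ℝ (ω (n + 1)).1.g (currentΔ p n (ω n).1) ∂(run P o p) := by
  have hΔ := memLp_currentΔ (o := o) h n
  have hz := integral_inner_noise (o := o) h n (V := fun ω => currentΔ p n (ω n).1)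
    (by fun_prop) (fun ω ω' hω => by simp only [hω n le_rfl]) hΔ
  have hi1 := integrable_inner_of_memLp hΔ (memLp_noise (o := o) h n)
  have hi2 := integrable_inner_of_memLp (memLp_gradient_y (o := o) h (n + 1)) hΔ
  have hi3 := integrable_inner_of_memLp (memLp_estimate (o := o) h n) hΔ
  have hi12 : Integrable (fun ω => inner ℝ (currentΔ p n (ω n).1) (estimateNoise P p (ω (n + 1))) +
      inner ℝ (gradient P.objective (ω (n + 1)).1.y) (currentΔ p n (ω n).1)) (run P o p) :=
    hi1.add hi2
  rw [← integral_gradient_inner h n]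
  calc _ = ∫ ω, (inner ℝ (currentΔ p n (ω n).1) (estimateNoise P p (ω (n + 1))) +
        inner ℝ (gradient P.objective (ω (n + 1)).1.y) (currentΔ p n (ω n).1) -
        L_H / 2 * p.δ ^ 2 * p.D) ∂(run P o p) := by
        rw [integral_sub hi12 (integrable_const _), integral_add hi1 hi2, hz]
        simp
    _ ≤ _ := by
        refine integral_mono_ae (hi12.sub (integrable_const _)) hi3 ?_
        filter_upwards [ae_regular (P := P) (o := o) (p := p)] with ω hω
        have h1 := (hω.near h.D_pos.le n).norm_currentΔ_le (p := p) n h.D_pos.le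
        have h2 := norm_meanEstimate_sub_gradient_le h.L_nonneg h.L_H_nonneg h.δ_pos h.lipschitz
          h.hessian (ω (n + 1)).1.y
        set Δ := currentΔ p n (ω n).1
        set m := meanEstimate P.objective p.δ (ω (n + 1)).1.y
        set g := gradient P.objective (ω (n + 1)).1.y
        have h0 := h.L_H_nonneg
        have h3 : |inner ℝ (m - g) Δ| ≤ L_H / 2 * p.δ ^ 2 * p.D :=
          (abs_real_inner_le_norm _ _).trans (mul_le_mul h2 h1 (norm_nonneg _) (by positivity))
        have h4 : inner ℝ Δ (estimateNoise P p (ω (n + 1))) =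
            inner ℝ (ω (n + 1)).1.g Δ - inner ℝ m Δ := by
          rw [real_inner_comm, estimateNoise, inner_sub_left]
        rw [inner_sub_left] at h3
        have := (abs_le.1 h3).1
        simp only [h4]
        linarith

end Moments
-- From the regret in a block to the gradient at the output
section Blocks

variable {d : ℕ} [NeZero d] {Z : Type*} [MeasurableSpace Z] {P : Problem d Z}
  {o : Feedback} {p : Params} {σ L L_H : ℝ}

/-- The sum of the gradients at the points `y` of block `k`. -/
noncomputable def gradientSum (P : Problem d Z) (p : Params) (k : ℕ) (ω : ℕ → Iterate d) : Vec d :=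
  ∑ m ∈ Finset.range p.M, gradient P.objective (ω (k * p.M + m + 1)).1.y

theorem memLp_gradientSum (h : Admissible P p σ L L_H) (k : ℕ) :
    MemLp (gradientSum P p k) 2 (run P o p) :=
  memLp_finsetSum _ fun j _ => memLp_gradient_y h (k * p.M + j + 1)

omit [NeZero d] in
theorem Regular.currentΔ_succ {ω : ℕ → Iterate d} (hω : Regular o p ω) (k : ℕ) {m : ℕ}
    (hm : m + 1 < p.M) :
    currentΔ p (k * p.M + (m + 1)) (ω (k * p.M + (m + 1))).1 =
      projBall p.D (currentΔ p (k * p.M + m) (ω (k * p.M + m)).1 -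
        p.η • (ω (k * p.M + m + 1)).1.g) := by
  have h1 : (k * p.M + (m + 1)) % p.M ≠ 0 := by
    rw [Nat.mul_add_mod', Nat.mod_eq_of_lt hm]; omega
  rw [currentΔ, if_neg h1]
  exact (hω.2 (k * p.M + m)).2.1

omit [NeZero d] in
theorem currentΔ_block_start (k : ℕ) (c : Core d) : currentΔ p (k * p.M + 0) c = 0 := by
  simp [currentΔ]

/-- This is the expectation of `mul_norm_sum_le`. The bias enters twice, which explains the factor
`2`: once against the comparator and once when the pairings with the increments are replaced by the
decrease of `f`. -/
theorem mul_integral_norm_gradientSum_le (h : Admissible P p σ L L_H) (hη : 0 < p.η) (k : ℕ)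
    {r : ℝ} (hr : 0 < r) (hr2 : p.M * noiseMomentBound d p σ L ≤ r ^ 2) :
    p.D * ∫ ω, ‖gradientSum P p k ω‖ ∂(run P o p) ≤
      ∫ ω, P.objective (ω (k * p.M)).1.x ∂(run P o p) -
        ∫ ω, P.objective (ω ((k + 1) * p.M)).1.x ∂(run P o p) +
      2 * (p.D * (p.M * (L_H / 2 * p.δ ^ 2))) + p.D * r + p.D ^ 2 / (2 * p.η) +
        p.η / 2 * r ^ 2 := by
  set b := L_H / 2 * p.δ ^ 2 with hb
  set μ := run P o p
  set a := k * p.M with ha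
  have hpath : ∀ᵐ ω ∂μ, p.D * ‖gradientSum P p k ω‖ ≤
      -(∑ m ∈ Finset.range p.M, inner ℝ (ω (a + m + 1)).1.g (currentΔ p (a + m) (ω (a + m)).1)) +
        p.D * (p.M * b) + p.D * ‖noiseSum P p a p.M ω‖ + p.D ^ 2 / (2 * p.η) +
        p.η / 2 * ∑ m ∈ Finset.range p.M, ‖(ω (a + m + 1)).1.g‖ ^ 2 := by
    filter_upwards [ae_regular (P := P) (o := o) (p := p)] with ω hω
    exact mul_norm_sum_le (Δ := fun m => currentΔ p (a + m) (ω (a + m)).1)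
      (g := fun m => (ω (a + m + 1)).1.g)
      (a := fun m => gradient P.objective (ω (a + m + 1)).1.y)
      (μ := fun m => meanEstimate P.objective p.δ (ω (a + m + 1)).1.y)
      h.D_pos.le hη (currentΔ_block_start k _) (fun m hm => hω.currentΔ_succ k hm)
      (fun m => norm_meanEstimate_sub_gradient_le h.L_nonneg h.L_H_nonneg h.δ_pos h.lipschitz
        h.hessian _)
  have hiA : Integrable (fun ω => p.D * ‖gradientSum P p k ω‖) μ :=
    ((memLp_gradientSum h k).integrable (by norm_num)).norm.const_mul p.D
  have hig : ∀ m, Integrable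
      (fun ω => inner ℝ (ω (a + m + 1)).1.g (currentΔ p (a + m) (ω (a + m)).1)) μ := fun m =>
    integrable_inner_of_memLp (memLp_estimate h (a + m)) (memLp_currentΔ h (a + m))
  have his : ∀ m, Integrable (fun ω : ℕ → Iterate d => ‖(ω (a + m + 1)).1.g‖ ^ 2) μ := fun m =>
    integrable_sq_of_memLp (memLp_estimate h (a + m))
  have hi1 : Integrable (fun ω : ℕ → Iterate d => -(∑ m ∈ Finset.range p.M,
      inner ℝ (ω (a + m + 1)).1.g (currentΔ p (a + m) (ω (a + m)).1))) μ :=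
    (integrable_finsetSum _ fun m _ => hig m).neg
  have hi2 : Integrable (fun ω : ℕ → Iterate d => -(∑ m ∈ Finset.range p.M,
      inner ℝ (ω (a + m + 1)).1.g (currentΔ p (a + m) (ω (a + m)).1)) + p.D * (p.M * b)) μ :=
    hi1.add (integrable_const _)
  have hiS : Integrable (fun ω => p.D * ‖noiseSum P p a p.M ω‖) μ :=
    ((memLp_noiseSum h a p.M).integrable (by norm_num)).norm.const_mul p.D
  have hi3 : Integrable (fun ω : ℕ → Iterate d => -(∑ m ∈ Finset.range p.M,
      inner ℝ (ω (a + m + 1)).1.g (currentΔ p (a + m) (ω (a + m)).1)) + p.D * (p.M * b) +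
      p.D * ‖noiseSum P p a p.M ω‖) μ := hi2.add hiS
  have hi4 : Integrable (fun ω : ℕ → Iterate d => -(∑ m ∈ Finset.range p.M,
      inner ℝ (ω (a + m + 1)).1.g (currentΔ p (a + m) (ω (a + m)).1)) + p.D * (p.M * b) +
      p.D * ‖noiseSum P p a p.M ω‖ + p.D ^ 2 / (2 * p.η)) μ := hi3.add (integrable_const _)
  have hi5 : Integrable (fun ω : ℕ → Iterate d =>
      p.η / 2 * ∑ m ∈ Finset.range p.M, ‖(ω (a + m + 1)).1.g‖ ^ 2) μ :=
    (integrable_finsetSum _ fun m _ => his m).const_mul _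
  have hint := integral_mono_ae hiA (hi4.add hi5) hpath
  simp only [Pi.add_apply] at hint
  rw [integral_const_mul, integral_add hi4 hi5, integral_add hi3 (integrable_const _),
    integral_add hi2 hiS, integral_add hi1 (integrable_const _), integral_neg,
    integral_finsetSum _ fun m _ => hig m, integral_const_mul p.D (fun ω => ‖noiseSum P p a p.M ω‖),
    integral_const_mul (p.η / 2),
    integral_finsetSum _ fun m _ => his m] at hint
  simp only [integral_const, probReal_univ, one_smul] at hint
  have hprog : ∀ N, ∫ ω, P.objective (ω (a + N)).1.x ∂μ - ∫ ω, P.objective (ω a).1.x ∂μ -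
      p.D * (N * b) ≤ ∑ m ∈ Finset.range N,
        ∫ ω, inner ℝ (ω (a + m + 1)).1.g (currentΔ p (a + m) (ω (a + m)).1) ∂μ := by
    intro N
    induction N with
    | zero => simp
    | succ N ih =>
      rw [Finset.sum_range_succ]
      have : ∫ ω, P.objective (ω (a + N + 1)).1.x ∂μ - ∫ ω, P.objective (ω (a + N)).1.x ∂μ -
          b * p.D ≤ ∫ ω, inner ℝ (ω (a + N + 1)).1.g (currentΔ p (a + N) (ω (a + N)).1) ∂μ :=
        integral_estimate_inner_ge h (a + N)
      push_cast
      rw [← add_assoc]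
      linarith
  have h1 := hprog p.M
  -- The same `r` controls the noise and the regret, since `noiseMomentBound` dominates
  -- `estimateBound`.
  have h2 : ∑ m ∈ Finset.range p.M, ∫ ω, ‖(ω (a + m + 1)).1.g‖ ^ 2 ∂μ ≤ r ^ 2 := by
    have h7 : ∀ m ∈ Finset.range p.M, ∫ ω, ‖(ω (a + m + 1)).1.g‖ ^ 2 ∂μ ≤ estimateBound d p σ L :=
      fun m _ => integral_estimate_sq_le h (a + m)
    refine (Finset.sum_le_sum h7).trans (le_trans ?_ hr2)
    rw [Finset.sum_const, Finset.card_range, nsmul_eq_mul]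
    refine mul_le_mul_of_nonneg_left ?_ (Nat.cast_nonneg _)
    have := estimateBound_nonneg (d := d) (p := p) (σ := σ) (L := L)
    unfold noiseMomentBound
    nlinarith [sq_nonneg (d * L)]
  have h3 : ∫ ω, ‖noiseSum P p a p.M ω‖ ∂μ ≤ r := integral_norm_noiseSum_le h a p.M hr hr2
  have h4 := mul_le_mul_of_nonneg_left h2 (by positivity : 0 ≤ p.η / 2)
  have h5 := mul_le_mul_of_nonneg_left h3 h.D_pos.le
  have h6 : (k + 1) * p.M = a + p.M := by rw [ha]; ring
  rw [h6]
  linarith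

omit [NeZero d] in
theorem Regular.norm_gradient_blockAverage_le (h : Admissible P p σ L L_H) (hM : 0 < p.M)
    {ω : ℕ → Iterate d} (hω : Regular o p ω) (k : Fin p.K) :
    ‖gradient P.objective (blockAverage p ω k)‖ ≤
      (p.M : ℝ)⁻¹ * ‖gradientSum P p k ω‖ + L_H / 2 * (p.M * p.D) ^ 2 := by
  set a := (k : ℕ) * p.M
  have hΔ : ∀ m, ‖currentΔ p (a + m) (ω (a + m)).1‖ ≤ p.D := fun m =>
    (hω.near h.D_pos.le (a + m)).norm_currentΔ_le _ h.D_pos.le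
  have hlt : ∀ i j, i < j → j < p.M →
      ‖(ω (a + j + 1)).1.y - (ω (a + i + 1)).1.y‖ ≤ p.M * p.D := fun i j hij hj =>
    norm_sub_le_of_steps (x := fun m => (ω (a + m)).1.x) (y := fun m => (ω (a + m + 1)).1.y)
      (fun m _ => by
        change ‖(ω (a + m + 1)).1.x - _‖ ≤ _
        rw [(hω.2 (a + m)).1, add_sub_cancel_left]; exact hΔ m)
      (fun m _ => (hω.2 (a + m)).2.2.1.trans (hΔ m))
      (fun m _ => (hω.2 (a + m)).2.2.2.1.trans (hΔ m)) hij hj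
  refine norm_gradient_average_le h.L_H_nonneg h.hessian hM
    (y := fun m => (ω (a + m + 1)).1.y) fun i hi j hj => ?_
  rcases lt_trichotomy i j with hij | rfl | hij
  · exact hlt i j hij hj
  · rw [sub_self, norm_zero]
    exact mul_nonneg (Nat.cast_nonneg _) h.D_pos.le
  · rw [norm_sub_rev]; exact hlt j i hij hi

theorem integral_norm_gradient_output (h : Admissible P p σ L L_H) (hK : 0 < p.K) :
    Integrable (fun y => ‖gradient P.objective y‖) (output P o p) ∧
      ∫ y, ‖gradient P.objective y‖ ∂(output P o p) =
        (p.K : ℝ)⁻¹ * ∑ k : Fin p.K,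
          ∫ ω, ‖gradient P.objective (blockAverage p ω k)‖ ∂(run P o p) := by
  have hm := h.measurable_gradient
  have hprob := isProbabilityMeasure_output P o p hK
  have : NeZero p.K := ⟨hK.ne'⟩
  have hu : IsProbabilityMeasure (uniformOn (Set.univ : Set (Fin p.K))) :=
    isProbabilityMeasure_uniformOn Set.finite_univ Set.univ_nonempty
  have hi : Integrable (fun y => ‖gradient P.objective y‖) (output P o p) :=
    (Integrable.of_bound hm.aestronglyMeasurable L
      (Filter.Eventually.of_forall fun y => norm_gradient_le h.L_nonneg h.lipschitz y)).norm
  refine ⟨hi, ?_⟩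
  have hb := measurable_blockAverage (d := d) p
  have hi2 := hi
  rw [output, integrable_map_measure (by fun_prop) hb.aemeasurable] at hi2
  rw [output, integral_map hb.aemeasurable (by fun_prop), integral_prod_symm (fun w => ‖gradient P.objective (blockAverage p w.1 w.2)‖) hi2,
    integral_fintype Integrable.of_finite]
  rw [Finset.mul_sum]
  refine Finset.sum_congr rfl fun k _ => ?_
  rw [smul_eq_mul]
  congr 1
  simp [measureReal_def, uniformOn_univ]

theorem integral_norm_gradient_output_le (h : Admissible P p σ L L_H) (hη : 0 < p.η)
    (hM : 0 < p.M) (hK : 0 < p.K) (hbdd : BddBelow (Set.range P.objective)) {γ : ℝ}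
    (hγ : P.objective 0 - ⨅ x, P.objective x ≤ γ)
    {r : ℝ} (hr : 0 < r) (hr2 : p.M * noiseMomentBound d p σ L ≤ r ^ 2) :
    ∫ y, ‖gradient P.objective y‖ ∂(output P o p) ≤
      γ / (p.K * (p.M * p.D)) + L_H * p.δ ^ 2 + L_H / 2 * (p.M * p.D) ^ 2 +
        (r + p.D / (2 * p.η) + p.η / (2 * p.D) * r ^ 2) / p.M := by
  rw [(integral_norm_gradient_output h hK).2]
  set μ := run P o p
  have hMr : (0 : ℝ) < p.M := by exact_mod_cast hM
  have hKr : (0 : ℝ) < p.K := by exact_mod_cast hK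
  have hD := h.D_pos
  have hiA : ∀ k, Integrable (fun ω => ‖gradientSum P p k ω‖) μ := fun k =>
    ((memLp_gradientSum h k).integrable (by norm_num)).norm
  have hblock : ∀ k : Fin p.K, ∫ ω, ‖gradient P.objective (blockAverage p ω k)‖ ∂μ ≤
      (p.M : ℝ)⁻¹ * ∫ ω, ‖gradientSum P p k ω‖ ∂μ + L_H / 2 * (p.M * p.D) ^ 2 := by
    intro k
    have hi : Integrable (fun ω => ‖gradient P.objective (blockAverage p ω k)‖) μ := by
      have hm := h.measurable_gradient
      have hb : Measurable (fun ω : ℕ → Iterate d => blockAverage p ω k) :=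
        (measurable_blockAverage (d := d) p).comp measurable_prodMk_right
      exact (Integrable.of_bound (hm.comp hb).aestronglyMeasurable L
        (Filter.Eventually.of_forall fun ω =>
          norm_gradient_le h.L_nonneg h.lipschitz (blockAverage p ω k))).norm
    refine (integral_mono_ae hi (((hiA k).const_mul (p.M : ℝ)⁻¹).add
      (integrable_const (L_H / 2 * (p.M * p.D) ^ 2))) ?_).trans_eq ?_
    · filter_upwards [ae_regular (P := P) (o := o) (p := p)] with ω hω
      exact hω.norm_gradient_blockAverage_le h hM k
    · simp only [Pi.add_apply]
      rw [integral_add ((hiA k).const_mul _) (integrable_const _), integral_const_mul]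
      simp
  -- Only `Δ` is reset between blocks; `x` continues, so the values of `f` at the block ends
  -- telescope.
  have htel : ∀ N : ℕ, p.D * ∑ k ∈ Finset.range N, ∫ ω, ‖gradientSum P p k ω‖ ∂μ ≤
      ∫ ω, P.objective (ω 0).1.x ∂μ - ∫ ω, P.objective (ω (N * p.M)).1.x ∂μ +
      N * (2 * (p.D * (p.M * (L_H / 2 * p.δ ^ 2))) + p.D * r + p.D ^ 2 / (2 * p.η) +
        p.η / 2 * r ^ 2) := by
    intro N
    induction N with
    | zero => simp
    | succ N ih =>
      rw [Finset.sum_range_succ, mul_add]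
      have := mul_integral_norm_gradientSum_le (o := o) h hη N hr hr2
      push_cast
      linarith
  have h0 : ∫ ω, P.objective (ω 0).1.x ∂μ = P.objective 0 := by
    have : (fun ω : ℕ → Iterate d => P.objective (ω 0).1.x) =ᵐ[μ] fun _ => P.objective 0 := by
      filter_upwards [ae_regular (P := P) (o := o) (p := p)] with ω hω
      rw [hω.1.1.1]
    rw [integral_congr_ae this]
    simp
  have hend : ⨅ x, P.objective x ≤ ∫ ω, P.objective (ω (p.K * p.M)).1.x ∂μ := by
    have := integral_mono (μ := μ) (integrable_const (⨅ x, P.objective x))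
      (integrable_objective_x h (p.K * p.M)) fun ω => ciInf_le hbdd _
    simpa using this
  have h1 := htel p.K
  rw [h0] at h1
  set Q := ∑ k ∈ Finset.range p.K, ∫ ω, ‖gradientSum P p k ω‖ ∂μ
  have h2 : p.D * Q ≤ γ + p.K * (2 * (p.D * (p.M * (L_H / 2 * p.δ ^ 2))) + p.D * r +
      p.D ^ 2 / (2 * p.η) + p.η / 2 * r ^ 2) := by linarith
  have h3 : Q ≤ (γ + p.K * (2 * (p.D * (p.M * (L_H / 2 * p.δ ^ 2))) + p.D * r +
      p.D ^ 2 / (2 * p.η) + p.η / 2 * r ^ 2)) / p.D := by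
    rw [le_div_iff₀ hD, mul_comm]; exact h2
  calc _ ≤ (p.K : ℝ)⁻¹ * ∑ k : Fin p.K, ((p.M : ℝ)⁻¹ * ∫ ω, ‖gradientSum P p k ω‖ ∂μ +
        L_H / 2 * (p.M * p.D) ^ 2) := by
        gcongr with k _
        exact hblock k
    _ = (p.K : ℝ)⁻¹ * ((p.M : ℝ)⁻¹ * Q + p.K * (L_H / 2 * (p.M * p.D) ^ 2)) := by
        rw [Finset.sum_add_distrib, ← Finset.mul_sum,
          Fin.sum_univ_eq_sum_range (fun k => ∫ ω, ‖gradientSum P p k ω‖ ∂μ)]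
        simp only [Finset.sum_const, Finset.card_univ, Fintype.card_fin, nsmul_eq_mul, Q]
    _ ≤ (p.K : ℝ)⁻¹ * ((p.M : ℝ)⁻¹ * ((γ + p.K * (2 * (p.D * (p.M * (L_H / 2 * p.δ ^ 2))) +
        p.D * r + p.D ^ 2 / (2 * p.η) + p.η / 2 * r ^ 2)) / p.D) +
        p.K * (L_H / 2 * (p.M * p.D) ^ 2)) := by gcongr
    _ = _ := by field_simp; ring

/-- Option I makes `2KM` calls. Option II makes `KM + 1`, and its initial call is absorbed because
`KM ≥ 1`. -/
theorem ae_queries_le (hM : 0 < p.M) (hK : 0 < p.K) :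
    ∀ᵐ ω ∂(run P o p), (queries p ω : ℝ) ≤ 2 * (p.K * p.M) := by
  filter_upwards [ae_regular (P := P) (o := o) (p := p)] with ω hω
  have h1 := hω.queries_eq (p.K * p.M)
  have h2 : 0 < p.K * p.M := Nat.mul_pos hK hM
  have h3 : queries p ω ≤ 2 * (p.K * p.M) := by
    rw [queries, h1]
    cases o <;> simp only [Feedback.startCost, Feedback.cost] <;> omega
  exact_mod_cast h3

end Blocks
-- Size of the moments in terms of the accuracy
section Complexity

/-- The scale of the second moment of the gradient estimate. -/
noncomputable def momentScale (L L_H σ ε₀ : ℝ) : ℝ := 48 * σ ^ 2 * L_H + (58 * L ^ 2 + 1) * ε₀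

/-- With `D ≤ δ` the bound is d²(24σ²/δ² + 58L²). Then 1/δ² = 2L_H/ε, and `ε ≤ ε₀` brings the
Lipschitz term to order 1/ε as well. The summand `1` in `momentScale` keeps the scale positive when
σ = L = 0. -/
theorem noiseMomentBound_le {d : ℕ} {p : Params} {L L_H σ ε₀ ε : ℝ} (hL_H : 0 < L_H) (hε : 0 < ε)
    (hε₀ : ε ≤ ε₀) (hδ : p.δ ^ 2 = ε / (2 * L_H)) (hδ0 : 0 < p.δ) (hM : 0 < p.M) :
    noiseMomentBound d p σ L ≤ d ^ 2 * momentScale L L_H σ ε₀ / ε := by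
  have hD : p.D ^ 2 ≤ p.δ ^ 2 := by
    have h1 : p.D ≤ p.δ := div_le_self hδ0.le (by exact_mod_cast hM)
    have h2 : 0 ≤ p.D := div_nonneg hδ0.le (Nat.cast_nonneg _)
    gcongr
  have hδ2 : 0 < p.δ ^ 2 := by positivity
  have h1 : noiseMomentBound d p σ L ≤ d ^ 2 * (24 * σ ^ 2 / p.δ ^ 2 + 58 * L ^ 2) := by
    calc noiseMomentBound d p σ L
        = 2 * (d ^ 2 / p.δ ^ 2 * (12 * σ ^ 2 + 12 * L ^ 2 * p.δ ^ 2 + 16 * L ^ 2 * p.D ^ 2)) +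
          2 * (d * L) ^ 2 := by
          rw [noiseMomentBound, estimateBound, answerBound, div_pow]; ring
      _ ≤ 2 * (d ^ 2 / p.δ ^ 2 * (12 * σ ^ 2 + 12 * L ^ 2 * p.δ ^ 2 + 16 * L ^ 2 * p.δ ^ 2)) +
          2 * (d * L) ^ 2 := by gcongr
      _ = _ := by field_simp; ring
  refine h1.trans ?_
  have h2 : 24 * σ ^ 2 / p.δ ^ 2 = 48 * σ ^ 2 * L_H / ε := by
    rw [hδ]; field_simp; ring
  rw [h2, momentScale, mul_div_assoc ((d : ℝ) ^ 2)]
  refine mul_le_mul_of_nonneg_left ?_ (by positivity)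
  rw [add_div]
  have h3 : 58 * L ^ 2 ≤ (58 * L ^ 2 + 1) * ε₀ / ε := by
    rw [le_div_iff₀ hε]
    nlinarith [sq_nonneg L, mul_le_mul_of_nonneg_left hε₀ (sq_nonneg L)]
  linarith

theorem rpow_neg_nine_halves {ε : ℝ} (hε : 0 < ε) :
    ε ^ (-(9 / 2) : ℝ) = (ε ^ 3 * (ε * √ε))⁻¹ := by
  rw [Real.rpow_neg hε.le, Real.sqrt_eq_rpow]
  congr 1
  rw [← Real.rpow_natCast ε 3, mul_comm ε, ← Real.rpow_add_one hε.ne', ← Real.rpow_add hε]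
  norm_num

end Complexity
end ZOO2NC

/-! ### Choice of the parameters and the final bounds -/

theorem theorem4p3 (L L_H σ γ ε₀ : ℝ) (hL : 0 ≤ L) (hL_H : 0 < L_H) (hσ : 0 ≤ σ)
    (hε₀ : 0 < ε₀) :
    ∃ C : ℝ, 0 < C ∧ ∀ (o : ZOO2NC.Feedback) (d : ℕ) [NeZero d] (ε : ℝ), 0 < ε → ε ≤ ε₀ →
      ∃ (M K : ℕ) (η : ℝ), 0 < M ∧ 0 < K ∧ 0 < η ∧
        ∀ (Z : Type*) [MeasurableSpace Z] (P : ZOO2NC.Problem d Z),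
          P.NoiseBound σ →
          BddBelow (Set.range P.objective) →
          P.objective 0 - ⨅ x, P.objective x ≤ γ →
          (∀ x y, |P.objective x - P.objective y| ≤ L * ‖x - y‖) →
          ZOO2NC.HasLipschitzHessian P.objective L_H →
          Integrable (fun y => ‖gradient P.objective y‖)
              (ZOO2NC.output P o ⟨√(ε / (2 * L_H)), η, M, K⟩) ∧
            ∫ y, ‖gradient P.objective y‖ ∂(ZOO2NC.output P o ⟨√(ε / (2 * L_H)), η, M, K⟩) ≤ ε ∧
            ∀ᵐ ω ∂(ZOO2NC.run P o ⟨√(ε / (2 * L_H)), η, M, K⟩),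
              (ZOO2NC.queries ⟨√(ε / (2 * L_H)), η, M, K⟩ ω : ℝ) ≤
                C * (d : ℝ) ^ 2 * ε ^ (-(9 / 2) : ℝ) := by
  set A := ZOO2NC.momentScale L L_H σ ε₀ with hA
  have hA0 : 0 < A := by rw [hA, ZOO2NC.momentScale]; positivity
  -- The constants give `M ≤ C₁ d² / ε³` and `K ≤ C₂ / (ε√ε)`. The second summands absorb the
  -- rounding in `M` and `K`, by `ε ≤ ε₀` and, for `M`, also `d ≥ 1`.
  set C₁ := 256 * A + ε₀ ^ 3 with hC₁
  set C₂ := 8 * |γ| * √(2 * L_H) + 2 * (ε₀ * √ε₀) with hC₂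
  have hsε₀ : 0 < √ε₀ := Real.sqrt_pos.2 hε₀
  have hC₁0 : 0 < C₁ := by positivity
  have hC₂0 : 0 < C₂ := by positivity
  refine ⟨2 * (C₂ * C₁), by positivity, fun o d _ ε hε hεε₀ => ?_⟩
  set δ := √(ε / (2 * L_H)) with hδ
  have hδ0 : 0 < δ := Real.sqrt_pos.2 (by positivity)
  have hδ2 : δ ^ 2 = ε / (2 * L_H) := Real.sq_sqrt (by positivity)
  have hd0 : 0 < d := NeZero.pos d
  have hd1 : (1 : ℝ) ≤ d := by exact_mod_cast hd0
  set G2 : ℝ := d ^ 2 * A / ε with hG2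
  have hG20 : 0 < G2 := by positivity
  -- The noise and regret terms amount to 2r/M = 2√(G2/M), which is at most ε/8 exactly when M ≥ 256
  -- G2/ε².
  set M := ⌈256 * G2 / ε ^ 2⌉₊ with hMdef
  -- This makes γ/(Kδ) at most ε/8; the added `1` keeps `K` positive when γ = 0.
  set K := ⌈8 * |γ| / (δ * ε)⌉₊ + 1 with hKdef
  have hM : 0 < M := Nat.ceil_pos.2 (by positivity)
  have hK : 0 < K := Nat.succ_pos _
  have hMr : (0 : ℝ) < M := by exact_mod_cast hM
  have hKr : (0 : ℝ) < K := by exact_mod_cast hK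
  set r := √(M * G2) with hr
  have hr0 : 0 < r := Real.sqrt_pos.2 (by positivity)
  have hr2 : r ^ 2 = M * G2 := Real.sq_sqrt (by positivity)
  have hMle : 256 * G2 / ε ^ 2 ≤ M := Nat.le_ceil _
  have hKle : 8 * |γ| / (δ * ε) ≤ K := by
    rw [hKdef]; push_cast; exact (Nat.le_ceil _).trans (by linarith)
  -- The stepsize `D / r` balances D/(2η) and ηr²/(2D): each equals r/2.
  refine ⟨M, K, δ / M / r, hM, hK, by positivity, fun Z _ P hN hbdd hγ hlip hH => ?_⟩
  set p : ZOO2NC.Params := ⟨δ, δ / M / r, M, K⟩ with hp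
  have hD : p.D = δ / M := rfl
  have hadm : ZOO2NC.Admissible P p σ L L_H :=
    ⟨hN, hlip, hH, hL, hL_H.le, hδ0, by rw [hD]; positivity⟩
  have hη : 0 < p.η := by change 0 < δ / M / r; positivity
  refine ⟨(ZOO2NC.integral_norm_gradient_output hadm hK).1, ?_, ?_⟩
  · have hbound := ZOO2NC.integral_norm_gradient_output_le (o := o) hadm hη hM hK hbdd hγ hr0 (by
      rw [hr2]
      exact mul_le_mul_of_nonneg_left
        (ZOO2NC.noiseMomentBound_le hL_H hε hεε₀ hδ2 hδ0 hM) hMr.le)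
    refine hbound.trans ?_
    have hMD : (p.M : ℝ) * p.D = δ := by
      change (M : ℝ) * (δ / M) = δ
      field_simp
    rw [hMD]
    change γ / (K * δ) + L_H * δ ^ 2 + L_H / 2 * δ ^ 2 +
      (r + δ / M / (2 * (δ / M / r)) + δ / M / r / (2 * (δ / M)) * r ^ 2) / M ≤ ε
    -- The error budget is ε/8 for the initial gap, ε/2 for the bias, ε/4 for averaging within a
    -- block and ε/8 for noise and regret.
    have h1 : γ / (K * δ) ≤ ε / 8 := by
      rw [div_le_iff₀ (by positivity)]
      rw [div_le_iff₀ (by positivity)] at hKle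
      have := le_abs_self γ
      linarith
    have h2 : L_H * δ ^ 2 = ε / 2 := by rw [hδ2]; field_simp
    have h3 : r + δ / M / (2 * (δ / M / r)) + δ / M / r / (2 * (δ / M)) * r ^ 2 = 2 * r := by
      field_simp; ring
    have h4 : r ≤ M * ε / 16 := by
      refine (sq_le_sq₀ hr0.le (by positivity)).1 ?_
      rw [div_le_iff₀ (by positivity)] at hMle
      rw [hr2]
      nlinarith [mul_le_mul_of_nonneg_left hMle hMr.le]
    have h5 : 2 * r / M ≤ ε / 8 := by
      rw [div_le_iff₀ hMr]; linarith
    rw [h3]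
    linarith
  · filter_upwards [ZOO2NC.ae_queries_le (P := P) (o := o) (p := p) hM hK] with ω hω
    refine hω.trans ?_
    change 2 * ((K : ℝ) * M) ≤ _
    have hsε : 0 < √ε := Real.sqrt_pos.2 hε
    have h1 : (M : ℝ) ≤ C₁ * d ^ 2 / ε ^ 3 := by
      have h2 : (M : ℝ) ≤ 256 * G2 / ε ^ 2 + 1 := (Nat.ceil_lt_add_one (by positivity)).le
      refine h2.trans ?_
      rw [le_div_iff₀ (by positivity)]
      have h3 : (256 * G2 / ε ^ 2 + 1) * ε ^ 3 = 256 * (d ^ 2 * A) + ε ^ 3 := by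
        rw [hG2]; field_simp
      have h4 : ε ^ 3 ≤ ε₀ ^ 3 := by gcongr
      have h5 : ε₀ ^ 3 * 1 ≤ ε₀ ^ 3 * (d : ℝ) ^ 2 := by
        gcongr
        exact one_le_pow₀ hd1
      rw [h3, hC₁]
      linarith
    have h2 : (K : ℝ) ≤ C₂ / (ε * √ε) := by
      have h3 : (K : ℝ) ≤ 8 * |γ| / (δ * ε) + 2 := by
        rw [hKdef]; push_cast
        have := (Nat.ceil_lt_add_one (show 0 ≤ 8 * |γ| / (δ * ε) by positivity)).le
        linarith
      refine h3.trans ?_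
      have h4 : δ * √(2 * L_H) = √ε := by
        rw [hδ, ← Real.sqrt_mul (by positivity)]
        congr 1
        field_simp
      rw [le_div_iff₀ (by positivity), add_mul]
      have h5 : 8 * |γ| / (δ * ε) * (ε * √ε) = 8 * |γ| * √(2 * L_H) := by
        rw [← h4]; field_simp
      have h6 : ε * √ε ≤ ε₀ * √ε₀ := by
        have := Real.sqrt_le_sqrt hεε₀
        gcongr
      rw [h5, hC₂]
      linarith
    calc 2 * ((K : ℝ) * M) ≤ 2 * (C₂ / (ε * √ε) * (C₁ * d ^ 2 / ε ^ 3)) := by gcongr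
      _ = _ := by
        rw [ZOO2NC.rpow_neg_nine_halves hε]
        field_simp
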